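/- Consider the class of equations $$u_t+a(u^n)_x=g(t)u_{xx},\qquad (1)$$ where $a\neq0$ and $n\neq0,1$ are real constants and $g$ is a smooth nonvanishing function on an open interval. Let $u_t+a(u^n)_x=g(t)u_{xx}$ and $\tilde u_{\tilde t}+\tilde a(\tilde u^{\tilde n})_{\tilde x}=\tilde g(\tilde t)\tilde u_{\tilde x\tilde x}$ be two equations of the class, and let $\mathcal T\colon \tilde t=T(t,x,u),\ \tilde x=X(t,x,u),\ \tilde u=U(t,x,u)$ be a map on a nonempty connected open set $\Omega$ of the space $(t,x,u)$ such that the first equation is defined over $\Omega$ and the second one over $\mathcal T(\Omega)$ (that is, $t$, resp. $\tilde t$, lies in the interval of $g$, resp. $\tilde g$, and $u$, resp. $\tilde u$, lies where the power $u^n$, resp. $\tilde u^{\tilde n}$, is a smooth real function: any real number for a natural exponent, any nonzero one for an integer exponent, a positive one otherwise). Then $\mathcal T$ is a point transformation (smooth, $\partial(T,X,U)/\partial(t,x,u)\neq0$ on $\Omega$) that connects the two equations (its second prolongation maps the part over $\Omega$ of the manifold of the first equation in the second-order jet space into the manifold of the second equation, wherever the prolongation is defined) if and only if $\tilde n=n$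 and the following holds. 1. If $n\neq2$, then $\mathcal T$ is the projection to the space $(t,x,u)$ of an element of the usual equivalence group $G^\sim$ that takes $(a,g,n)$ to $(\tilde a,\tilde g,\tilde n)$: there are constants $\delta_1,\dots,\delta_5$ with $\delta_1\delta_3\delta_5\neq0$ such that on $\Omega$ $$\tilde t=\delta_1t+\delta_2,\quad \tilde x=\delta_3x+\delta_4,\quad \tilde u=\delta_5u,\quad \tilde a=\frac{\delta_3}{\delta_1}\delta_5^{1-n}a,\quad \tilde g(\tilde t)=\frac{\delta_3^2}{\delta_1}g(t).$$ 2. If $n=2$, then $\mathcal T$ is the projection to the space $(t,x,u)$ of an element of the generalized equivalence group $\hat G^\sim_2$ that takes $(a,g)$ to $(\tilde a,\tilde g)$: there are constants $\alpha,\beta,\gamma,\delta,\kappa,\mu_1,\mu_0,\sigma$ with $\alpha\delta-\beta\gamma\neq0$ and $\kappa\sigma\neq0$ such that on $\Omega$ one has $\gamma t+\delta\neq0$ and $$\tilde t=\frac{\alpha t+\beta}{\gamma t+\delta},\quad \tilde x=\frac{\kappa x+\mu_1t+\mu_0}{\gamma t+\delta},\quad \tilde u=\frac{\sigma}{2a(\alpha\delta-\beta\gamma)}\bigl(2a\kappa(\gamma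 t+\delta)u-\kappa\gamma x+\mu_1\delta-\mu_0\gamma\bigr),$$ $$\tilde a=\frac a\sigma,\quad \tilde g(\tilde t)=\frac{\kappa^2}{\alpha\delta-\beta\gamma}g(t).$$ -/

import Mathlib

open Set
open scoped ContDiff

noncomputable section

namespace GenBurgers

/-- The set of real `u` near which `u ↦ u ^ n` is a well-defined smooth real function: all
positive `u`; also negative `u` if `n` is an integer; also `u = 0` if `n` is a natural number. -/
def powDomain (n : ℝ) : Set ℝ :=
  {u | 0 < u ∨ ((∃ k : ℤ, n = k) ∧ u ≠ 0) ∨ ∃ k : ℕ, n = k}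

/-- An equation `u_t + a (u^n)_x = g(t) u_xx` of the class: `a ≠ 0`, `n ≠ 0, 1` are real constants
and `g` is a smooth nonvanishing function on an open interval `I`. -/
structure Eqn where
  n : ℝ
  a : ℝ
  g : ℝ → ℝ
  I : Set ℝ
  n_ne_zero : n ≠ 0
  n_ne_one : n ≠ 1
  a_ne_zero : a ≠ 0
  isOpen_I : IsOpen I
  ordConnected_I : I.OrdConnected
  smooth_g : ContDiffOn ℝ ∞ g I
  g_ne_zero : ∀ t ∈ I, g t ≠ 0

/-- The part of the space of the variables `(t, x, u)` on which the equation is defined. -/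
def Eqn.domain (E : Eqn) : Set (ℝ × ℝ × ℝ) :=
  {p | p.1 ∈ E.I ∧ p.2.2 ∈ powDomain E.n}

/-- The first-order jet space, with coordinates `(t, x, u, u_t, u_x)`. -/
abbrev Jet1 : Type := ℝ × ℝ × ℝ × ℝ × ℝ

/-- The second-order jet space, with coordinates `(t, x, u, u_t, u_x, u_tt, u_tx, u_xx)`. -/
structure Jet2 where
  t : ℝ
  x : ℝ
  u : ℝ
  ut : ℝ
  ux : ℝ
  utt : ℝ
  utx : ℝ
  uxx : ℝ

/-- The projection of a 2-jet to the space of the variables `(t, x, u)`. -/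
def Jet2.point (j : Jet2) : ℝ × ℝ × ℝ := (j.t, j.x, j.u)

/-- The projection of a 2-jet to the first-order jet space. -/
def Jet2.toJet1 (j : Jet2) : Jet1 := (j.t, j.x, j.u, j.ut, j.ux)

/-- The manifold in the second-order jet space that the equation determines; here
`(u^n)_x = n u^(n-1) u_x`. -/
def Eqn.manifold (E : Eqn) : Set Jet2 :=
  {j | j.point ∈ E.domain ∧
    j.ut + E.a * (E.n * j.u ^ (E.n - 1) * j.ux) = E.g j.t * j.uxx}

/-- The total derivative `D_t F = F_t + u_t F_u` of a function `F` of `(t, x, u)`. -/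
def totalT (F : ℝ × ℝ × ℝ → ℝ) (z : Jet1) : ℝ :=
  fderiv ℝ F (z.1, z.2.1, z.2.2.1) (1, 0, z.2.2.2.1)

/-- The total derivative `D_x F = F_x + u_x F_u` of a function `F` of `(t, x, u)`. -/
def totalX (F : ℝ × ℝ × ℝ → ℝ) (z : Jet1) : ℝ :=
  fderiv ℝ F (z.1, z.2.1, z.2.2.1) (0, 1, z.2.2.2.2)

/-- The total derivative `D_t P = P_t + u_t P_u + u_tt P_{u_t} + u_tx P_{u_x}` of a function `P`
on the first-order jet space. -/
def totalT₁ (P : Jet1 → ℝ) (j : Jet2) : ℝ :=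
  fderiv ℝ P j.toJet1 (1, 0, j.ut, j.utt, j.utx)

/-- The total derivative `D_x P = P_x + u_x P_u + u_tx P_{u_t} + u_xx P_{u_x}` of a function `P`
on the first-order jet space. -/
def totalX₁ (P : Jet1 → ℝ) (j : Jet2) : ℝ :=
  fderiv ℝ P j.toJet1 (0, 1, j.ux, j.utx, j.uxx)

section Prolongation

/-- The component `T` of `(t, x, u) ↦ (T, X, U)`. -/
def compT (Φ : ℝ × ℝ × ℝ → ℝ × ℝ × ℝ) (p : ℝ × ℝ × ℝ) : ℝ := (Φ p).1

/-- The component `X` of `(t, x, u) ↦ (T, X, U)`. -/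
def compX (Φ : ℝ × ℝ × ℝ → ℝ × ℝ × ℝ) (p : ℝ × ℝ × ℝ) : ℝ := (Φ p).2.1

/-- The component `U` of `(t, x, u) ↦ (T, X, U)`. -/
def compU (Φ : ℝ × ℝ × ℝ → ℝ × ℝ × ℝ) (p : ℝ × ℝ × ℝ) : ℝ := (Φ p).2.2

/-- The Jacobian determinant `∂(T, X, U) / ∂(t, x, u)`. -/
def jacobian (Φ : ℝ × ℝ × ℝ → ℝ × ℝ × ℝ) (p : ℝ × ℝ × ℝ) : ℝ :=
  Matrix.det
    !![fderiv ℝ (compT Φ) p (1, 0, 0), fderiv ℝ (compT Φ) p (0, 1, 0),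
        fderiv ℝ (compT Φ) p (0, 0, 1);
      fderiv ℝ (compX Φ) p (1, 0, 0), fderiv ℝ (compX Φ) p (0, 1, 0),
        fderiv ℝ (compX Φ) p (0, 0, 1);
      fderiv ℝ (compU Φ) p (1, 0, 0), fderiv ℝ (compU Φ) p (0, 1, 0),
        fderiv ℝ (compU Φ) p (0, 0, 1)]

/-- A point transformation on the region `Ω`: smooth, with nonvanishing Jacobian determinant. -/
def IsPointTransformation (Φ : ℝ × ℝ × ℝ → ℝ × ℝ × ℝ) (Ω : Set (ℝ × ℝ × ℝ)) : Prop :=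
  ContDiffOn ℝ ∞ Φ Ω ∧ ∀ p ∈ Ω, jacobian Φ p ≠ 0

/-- `D_t T D_x X - D_x T D_t X`. Where it does not vanish, the image of the graph of `u(t, x)` is
again, locally, the graph of a function of the new independent variables. -/
def baseJacobian (Φ : ℝ × ℝ × ℝ → ℝ × ℝ × ℝ) (z : Jet1) : ℝ :=
  totalT (compT Φ) z * totalX (compX Φ) z - totalX (compT Φ) z * totalT (compX Φ) z

/-- The new derivative with respect to the new time, from the old total derivatives `dt`, `dx`. -/
def newT (Φ : ℝ × ℝ × ℝ → ℝ × ℝ × ℝ) (z : Jet1) (dt dx : ℝ) : ℝ :=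
  (totalX (compX Φ) z * dt - totalT (compX Φ) z * dx) / baseJacobian Φ z

/-- The new derivative with respect to the new space variable, from the old total derivatives
`dt`, `dx`. -/
def newX (Φ : ℝ × ℝ × ℝ → ℝ × ℝ × ℝ) (z : Jet1) (dt dx : ℝ) : ℝ :=
  (totalT (compT Φ) z * dx - totalX (compT Φ) z * dt) / baseJacobian Φ z

/-- The new first derivative `u_t` as a function on the old first-order jet space. -/
def prolongUt (Φ : ℝ × ℝ × ℝ → ℝ × ℝ × ℝ) (z : Jet1) : ℝ :=
  newT Φ z (totalT (compU Φ) z) (totalX (compU Φ) z)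

/-- The new first derivative `u_x` as a function on the old first-order jet space. -/
def prolongUx (Φ : ℝ × ℝ × ℝ → ℝ × ℝ × ℝ) (z : Jet1) : ℝ :=
  newX Φ z (totalT (compU Φ) z) (totalX (compU Φ) z)

/-- The second prolongation of a point transformation (where `baseJacobian` does not vanish). -/
def prolong (Φ : ℝ × ℝ × ℝ → ℝ × ℝ × ℝ) (j : Jet2) : Jet2 where
  t := compT Φ j.point
  x := compX Φ j.point
  u := compU Φ j.point
  ut := prolongUt Φ j.toJet1
  ux := prolongUx Φ j.toJet1
  utt := newT Φ j.toJet1 (totalT₁ (prolongUt Φ) j) (totalX₁ (prolongUt Φ) j)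
  utx := newX Φ j.toJet1 (totalT₁ (prolongUt Φ) j) (totalX₁ (prolongUt Φ) j)
  uxx := newX Φ j.toJet1 (totalT₁ (prolongUx Φ) j) (totalX₁ (prolongUx Φ) j)

end Prolongation

/-- The equations `E` and `E'` are connected by `Φ` over the region `Ω`: `Φ` is a point
transformation on `Ω`, and `E'`, written in the old variables, holds identically on the manifold
of `E` in the second-order jet space. -/
def Connects (Φ : ℝ × ℝ × ℝ → ℝ × ℝ × ℝ) (Ω : Set (ℝ × ℝ × ℝ)) (E E' : Eqn) : Prop :=
  IsPointTransformation Φ Ω ∧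
    ∀ j ∈ E.manifold, j.point ∈ Ω → baseJacobian Φ j.toJet1 ≠ 0 → prolong Φ j ∈ E'.manifold

/-- A point of the space of the variables `t, x, u` and the arbitrary elements `a, g, n`. -/
structure ExtPoint where
  t : ℝ
  x : ℝ
  u : ℝ
  a : ℝ
  g : ℝ
  n : ℝ

/-- The point over `(t, x, u)` with the values of the arbitrary elements of the equation `E`. -/
def Eqn.lift (E : Eqn) (p : ℝ × ℝ × ℝ) : ExtPoint where
  t := p.1
  x := p.2.1
  u := p.2.2
  a := E.a
  g := E.g p.1
  n := E.n

/-- The elements of the usual equivalence group of the class, by their parameters. -/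
structure UsualEquiv where
  δ₁ : ℝ
  δ₂ : ℝ
  δ₃ : ℝ
  δ₄ : ℝ
  δ₅ : ℝ
  ne_zero : δ₁ * δ₃ * δ₅ ≠ 0

/-- The transformation of the extended space given by an element of the usual equivalence group. -/
def UsualEquiv.act (S : UsualEquiv) (z : ExtPoint) : ExtPoint where
  t := S.δ₁ * z.t + S.δ₂
  x := S.δ₃ * z.x + S.δ₄
  u := S.δ₅ * z.u
  a := S.δ₃ / S.δ₁ * S.δ₅ ^ (1 - z.n) * z.a
  g := S.δ₃ ^ 2 / S.δ₁ * z.g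
  n := z.n

/-- The elements of the generalized equivalence group of the subclass `n = 2`, by their
parameters. -/
structure GeneralizedEquiv where
  α : ℝ
  β : ℝ
  γ : ℝ
  δ : ℝ
  κ : ℝ
  μ₁ : ℝ
  μ₀ : ℝ
  σ : ℝ
  det_ne_zero : α * δ - β * γ ≠ 0
  ne_zero : κ * σ ≠ 0

/-- The transformation of the extended space given by an element of the generalized equivalence
group, to be used where `γ t + δ ≠ 0`; `n = 2` is not changed. -/
def GeneralizedEquiv.act (S : GeneralizedEquiv) (z : ExtPoint) : ExtPoint where
  t := (S.α * z.t + S.β) / (S.γ * z.t + S.δ)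
  x := (S.κ * z.x + S.μ₁ * z.t + S.μ₀) / (S.γ * z.t + S.δ)
  u := S.σ / (2 * z.a * (S.α * S.δ - S.β * S.γ)) *
    (2 * z.a * S.κ * (S.γ * z.t + S.δ) * z.u - S.κ * S.γ * z.x + S.μ₁ * S.δ - S.μ₀ * S.γ)
  a := z.a / S.σ
  g := S.κ ^ 2 / (S.α * S.δ - S.β * S.γ) * z.g
  n := z.n

/-- Over `Ω`, the transformation `F` of the extended space projects to `Φ` and takes the arbitrary
elements of `E` to those of `E'`. -/
def ProjectsTo (F : ExtPoint → ExtPoint) (Φ : ℝ × ℝ × ℝ → ℝ × ℝ × ℝ) (Ω : Set (ℝ × ℝ × ℝ))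
    (E E' : Eqn) : Prop :=
  ∀ p ∈ Ω, F (E.lift p) = E'.lift (Φ p)

end GenBurgers

end

/-! The proof is the direct method: the equation `E`, solved for `u_xx`, is substituted into the
transformed equation `E'`, and the result is split with respect to the jet variables that remain
free. Since `u_tt` is free and the new `u_xx` cannot depend on it, `T` depends on `t` alone
(`Connects.pd_compT_eq_zero`). The coefficient of `u_t` gives `X_u = 0` and `X_x² g = T_t g'(T)`,
whence `X_xx = 0`; the powers of `u_x` give `U_uu = 0` and two more equations. This is reversible,
so connecting the equations is equivalent to the system `DeterminingEqs`
(`connects_iff_determiningEqs`), and both directions of the theorem become statements about that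
system.

Differentiating `linear` along `u` yields an equation between constant multiples, in `u`, of
`U^(n'-2)` and `u^(n-2)` (`power_eq`). As `U` is affine in `u`, logarithmic differentiation gives
`n' = n`. If `n ≠ 2`, the powers force `U` to be proportional to `u`, and everything else becomes
affine with constant coefficients (`affine_of_ne_two`). If `n = 2`, the power is trivial, so `U` may
contain a shift; it is expressed through `X_t`, `X_x`, `T_t`, and `T`, `X` satisfy differential
equations in `t` (`quadratic_reduce`) whose solutions are fractional linear
(`projective_of_eq_two`). -/

namespace GenBurgers

/-! ### Directional derivatives on the space `(t, x, u)` -/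

/-- The derivative of `F` in the direction `v`. -/
noncomputable def pd (v : ℝ × ℝ × ℝ) (F : ℝ × ℝ × ℝ → ℝ) (p : ℝ × ℝ × ℝ) : ℝ := fderiv ℝ F p v

/-- `F` has the derivative `a` at `p` in the direction `v`. -/
def HasPD (v : ℝ × ℝ × ℝ) (F : ℝ × ℝ × ℝ → ℝ) (a : ℝ) (p : ℝ × ℝ × ℝ) : Prop :=
  HasDerivAt (fun s : ℝ => F (p + s • v)) a 0

/-- The unit vector along the coordinate `t`. -/
def et : ℝ × ℝ × ℝ := (1, 0, 0)

/-- The unit vector along the coordinate `x`. -/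
def ex : ℝ × ℝ × ℝ := (0, 1, 0)

/-- The unit vector along the coordinate `u`. -/
def eu : ℝ × ℝ × ℝ := (0, 0, 1)

@[simp] theorem et_components : et.1 = 1 ∧ et.2.1 = 0 ∧ et.2.2 = 0 := ⟨rfl, rfl, rfl⟩
@[simp] theorem ex_components : ex.1 = 0 ∧ ex.2.1 = 1 ∧ ex.2.2 = 0 := ⟨rfl, rfl, rfl⟩
@[simp] theorem eu_components : eu.1 = 0 ∧ eu.2.1 = 0 ∧ eu.2.2 = 1 := ⟨rfl, rfl, rfl⟩

local notation "∂ₜ" => pd et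
local notation "∂ₓ" => pd ex
local notation "∂ᵤ" => pd eu

section

variable {Ω : Set (ℝ × ℝ × ℝ)} {F G : ℝ × ℝ × ℝ → ℝ} {p v w : ℝ × ℝ × ℝ} {a b : ℝ}

theorem HasPD.unique (h : HasPD v F a p) (h' : HasPD v F b p) : a = b :=
  HasDerivAt.unique h h'

theorem eventually_line_mem (hΩ : IsOpen Ω) (hp : p ∈ Ω) (v : ℝ × ℝ × ℝ) :
    ∀ᶠ s : ℝ in nhds 0, p + s • v ∈ Ω := by
  have hc : ContinuousAt (fun s : ℝ => p + s • v) 0 := by fun_prop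
  exact hc (hΩ.mem_nhds (by simpa using hp))

theorem HasPD.congr (hΩ : IsOpen Ω) (hp : p ∈ Ω) (h : HasPD v F a p) (e : ∀ q ∈ Ω, G q = F q) :
    HasPD v G a p := by
  refine HasDerivAt.congr_of_eventuallyEq h ?_
  filter_upwards [eventually_line_mem hΩ hp v] with s hs using e _ hs

/-- The device for differentiating an identity that holds on `Ω`: each side is differentiated by the
rules for `HasPD`, and the results are equated. -/
theorem HasPD.eq_of_eqOn (hΩ : IsOpen Ω) (hp : p ∈ Ω) (e : ∀ q ∈ Ω, F q = G q)
    (h : HasPD v F a p) (h' : HasPD v G b p) : a = b :=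
  h.unique (h'.congr hΩ hp e)

theorem DifferentiableAt.hasPD (h : DifferentiableAt ℝ F p) (v : ℝ × ℝ × ℝ) :
    HasPD v F (pd v F p) p :=
  h.hasFDerivAt.hasLineDerivAt v

theorem differentiableAt_of_smooth (hΩ : IsOpen Ω) (h : ContDiffOn ℝ ∞ F Ω) (hp : p ∈ Ω) :
    DifferentiableAt ℝ F p :=
  (h.contDiffAt (hΩ.mem_nhds hp)).differentiableAt (by simp)

theorem hasPD_of_smooth (hΩ : IsOpen Ω) (h : ContDiffOn ℝ ∞ F Ω) (hp : p ∈ Ω) (v : ℝ × ℝ × ℝ) :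
    HasPD v F (pd v F p) p :=
  DifferentiableAt.hasPD (differentiableAt_of_smooth hΩ h hp) v

theorem smooth_pd (hΩ : IsOpen Ω) (h : ContDiffOn ℝ ∞ F Ω) (v : ℝ × ℝ × ℝ) :
    ContDiffOn ℝ ∞ (pd v F) Ω :=
  (h.fderiv_of_isOpen hΩ (by simp)).clm_apply contDiffOn_const

theorem pd_eqOn (hΩ : IsOpen Ω) (hp : p ∈ Ω) (e : ∀ q ∈ Ω, F q = G q) (v : ℝ × ℝ × ℝ) :
    pd v F p = pd v G p := by
  have : F =ᶠ[nhds p] G := by filter_upwards [hΩ.mem_nhds hp] with q hq using e q hq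
  simp only [pd, this.fderiv_eq]

theorem pd_const (c : ℝ) : pd v (fun _ => c) p = 0 := by simp [pd]

theorem pd_eq_zero_of_eqOn (hΩ : IsOpen Ω) (hp : p ∈ Ω) {c : ℝ} (e : ∀ q ∈ Ω, F q = c)
    (v : ℝ × ℝ × ℝ) : pd v F p = 0 :=
  (pd_eqOn hΩ hp e v).trans (pd_const c)

theorem pd_comm (hΩ : IsOpen Ω) (h : ContDiffOn ℝ ∞ F Ω) (hp : p ∈ Ω) (v w : ℝ × ℝ × ℝ) :
    pd v (pd w F) p = pd w (pd v F) p := by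
  have hF := h.contDiffAt (hΩ.mem_nhds hp)
  have hd : DifferentiableAt ℝ (fderiv ℝ F) p :=
    (hF.fderiv_right (m := 1) (by norm_cast)).differentiableAt (by simp)
  have hs : IsSymmSndFDerivAt ℝ F p := hF.isSymmSndFDerivAt (by
    simp only [minSmoothness_of_isRCLikeNormedField]; exact ENat.LEInfty.out)
  have key : ∀ v w : ℝ × ℝ × ℝ, pd v (pd w F) p = fderiv ℝ (fderiv ℝ F) p v w := by
    intro v w
    have : HasFDerivAt (pd w F) _ p := hd.hasFDerivAt.clm_apply (hasFDerivAt_const w p)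
    change fderiv ℝ (pd w F) p v = _
    rw [this.fderiv]
    simp
  rw [key, key, hs.eq]

theorem fderiv_apply_eq (F : ℝ × ℝ × ℝ → ℝ) (p : ℝ × ℝ × ℝ) (x y z : ℝ) :
    fderiv ℝ F p (x, y, z) = x * ∂ₜ F p + y * ∂ₓ F p + z * ∂ᵤ F p := by
  have : ((x, y, z) : ℝ × ℝ × ℝ) =
      x • et + y • ex + z • eu := by simp [et, ex, eu]
  rw [this, map_add, map_add, map_smul, map_smul, map_smul]
  simp [pd]

theorem eq_of_pd_eq_zero (hΩ : IsOpen Ω) (hc : IsPreconnected Ω) (h : ContDiffOn ℝ ∞ F Ω)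
    (ht : ∀ p ∈ Ω, ∂ₜ F p = 0) (hx : ∀ p ∈ Ω, ∂ₓ F p = 0) (hu : ∀ p ∈ Ω, ∂ᵤ F p = 0)
    {p q : ℝ × ℝ × ℝ} (hp : p ∈ Ω) (hq : q ∈ Ω) : F q = F p := by
  refine hΩ.is_const_of_fderiv_eq_zero hc (h.differentiableOn (by simp)) ?_ hq hp
  intro y hy
  refine ContinuousLinearMap.ext fun v => ?_
  obtain ⟨v₁, v₂, v₃⟩ := v
  simp [fderiv_apply_eq, ht y hy, hx y hy, hu y hy]

theorem HasPD.pd_eq (hd : DifferentiableAt ℝ F p) (h : HasPD v F a p) : pd v F p = a :=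
  (DifferentiableAt.hasPD hd v).unique h

theorem hasPD_const (c : ℝ) : HasPD v (fun _ => c) 0 p := hasDerivAt_const _ _

theorem hasPD_t : HasPD v (fun q => q.1) v.1 p := by
  simpa [HasPD] using ((hasDerivAt_id (0 : ℝ)).mul_const v.1).const_add p.1

theorem hasPD_x : HasPD v (fun q => q.2.1) v.2.1 p := by
  simpa [HasPD] using ((hasDerivAt_id (0 : ℝ)).mul_const v.2.1).const_add p.2.1

theorem hasPD_u : HasPD v (fun q => q.2.2) v.2.2 p := by
  simpa [HasPD] using ((hasDerivAt_id (0 : ℝ)).mul_const v.2.2).const_add p.2.2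

theorem HasPD.add (h : HasPD v F a p) (h' : HasPD v G b p) :
    HasPD v (fun q => F q + G q) (a + b) p :=
  HasDerivAt.add h h'

theorem HasPD.sub (h : HasPD v F a p) (h' : HasPD v G b p) :
    HasPD v (fun q => F q - G q) (a - b) p :=
  HasDerivAt.sub h h'

theorem HasPD.mul (h : HasPD v F a p) (h' : HasPD v G b p) :
    HasPD v (fun q => F q * G q) (a * G p + F p * b) p := by
  have := HasDerivAt.mul h h'
  simp only [zero_smul, add_zero] at this
  exact this

theorem HasPD.div (h : HasPD v F a p) (h' : HasPD v G b p) (h0 : G p ≠ 0) :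
    HasPD v (fun q => F q / G q) ((a * G p - F p * b) / G p ^ 2) p := by
  have := HasDerivAt.div h h' (by simpa using h0)
  simp only [zero_smul, add_zero] at this
  exact this

theorem HasPD.const_mul (c : ℝ) (h : HasPD v F a p) : HasPD v (fun q => c * F q) (c * a) p :=
  HasDerivAt.const_mul c h

theorem HasPD.comp {f : ℝ → ℝ} (hf : HasDerivAt f b (F p)) (h : HasPD v F a p) :
    HasPD v (fun q => f (F q)) (b * a) p :=
  HasDerivAt.comp (0 : ℝ) (h₂ := f) (h := fun s : ℝ => F (p + s • v)) (by simpa using hf) h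

theorem HasPD.rpow {r : ℝ} (h : HasPD v F a p) (h0 : F p ≠ 0 ∨ 1 ≤ r) :
    HasPD v (fun q => F q ^ r) (r * F p ^ (r - 1) * a) p :=
  HasPD.comp (f := fun y => y ^ r) (Real.hasDerivAt_rpow_const h0) h

/-- A differentiable function whose product with the coordinate `u` vanishes is zero. -/
theorem eq_zero_of_u_mul_eq_zero (hΩ : IsOpen Ω) (h : ∀ q ∈ Ω, ∃ a, HasPD eu F a q)
    (e : ∀ q ∈ Ω, q.2.2 * F q = 0) : ∀ q ∈ Ω, F q = 0 := by
  intro q hq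
  rcases mul_eq_zero.1 (e q hq) with h0 | h0
  · obtain ⟨a, ha⟩ := h q hq
    -- At a point with `u = 0`, the `u`-derivative of `u F = 0` is `F = 0`.
    have := HasPD.eq_of_eqOn hΩ hq e (hasPD_u.mul ha) (hasPD_const 0)
    simpa [h0] using this
  · exact h0

theorem pd_pd_eq_zero (hΩ : IsOpen Ω) (h : ContDiffOn ℝ ∞ F Ω) {c : ℝ}
    (e : ∀ q ∈ Ω, pd v F q = c) (w : ℝ × ℝ × ℝ) : ∀ q ∈ Ω, pd v (pd w F) q = 0 := by
  intro q hq
  rw [pd_comm hΩ h hq, pd_eq_zero_of_eqOn hΩ hq e]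

/-- A function with constant partial derivatives on a connected open set is affine. -/
theorem exists_affine (hΩ : IsOpen Ω) (hc : IsConnected Ω) (h : ContDiffOn ℝ ∞ F Ω) {c₁ c₂ c₃ : ℝ}
    (ht : ∀ p ∈ Ω, ∂ₜ F p = c₁) (hx : ∀ p ∈ Ω, ∂ₓ F p = c₂) (hu : ∀ p ∈ Ω, ∂ᵤ F p = c₃) :
    ∃ d, ∀ q ∈ Ω, F q = c₁ * q.1 + c₂ * q.2.1 + c₃ * q.2.2 + d := by
  obtain ⟨p, hp⟩ := hc.nonempty
  set H : ℝ × ℝ × ℝ → ℝ := fun q => F q - (c₁ * q.1 + c₂ * q.2.1 + c₃ * q.2.2) with hH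
  have hs : ContDiffOn ℝ ∞ H Ω := h.sub (ContDiff.contDiffOn (by fun_prop))
  have key : ∀ q ∈ Ω, ∀ v, pd v H q = pd v F q - (c₁ * v.1 + c₂ * v.2.1 + c₃ * v.2.2) := by
    intro q hq v
    exact HasPD.pd_eq (differentiableAt_of_smooth hΩ hs hq) ((hasPD_of_smooth hΩ h hq v).sub
      (((hasPD_t.const_mul c₁).add (hasPD_x.const_mul c₂)).add (hasPD_u.const_mul c₃)))
  refine ⟨H p, fun q hq => ?_⟩
  have : H q = H p := eq_of_pd_eq_zero hΩ hc.isPreconnected hs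
    (fun q hq => by simp [key q hq, ht q hq]) (fun q hq => by simp [key q hq, hx q hq])
    (fun q hq => by simp [key q hq, hu q hq]) hp hq
  rw [← this, hH]
  ring

end

/-! ### Jets, prolongation, and why `T` depends on `t` alone -/

section

/-- The projection of a 1-jet to the space of the variables `(t, x, u)`. -/
def basePoint (z : Jet1) : ℝ × ℝ × ℝ := (z.1, z.2.1, z.2.2.1)

/-- `P` has the derivative `a` at the 1-jet `z` in the direction `v`. -/
def HasJD (v : Jet1) (P : Jet1 → ℝ) (a : ℝ) (z : Jet1) : Prop :=
  HasDerivAt (fun s : ℝ => P (z + s • v)) a 0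

variable {Ω : Set (ℝ × ℝ × ℝ)} {F : ℝ × ℝ × ℝ → ℝ} {P Q : Jet1 → ℝ} {z v : Jet1} {a b : ℝ}
  {Φ : ℝ × ℝ × ℝ → ℝ × ℝ × ℝ}

theorem HasJD.fderiv_eq (h : HasJD v P a z) (hd : DifferentiableAt ℝ P z) :
    fderiv ℝ P z v = a :=
  HasDerivAt.unique (hd.hasFDerivAt.hasLineDerivAt v) h

theorem HasJD.sub (h : HasJD v P a z) (h' : HasJD v Q b z) :
    HasJD v (fun z => P z - Q z) (a - b) z :=
  HasDerivAt.sub h h'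

theorem HasJD.mul (h : HasJD v P a z) (h' : HasJD v Q b z) :
    HasJD v (fun z => P z * Q z) (a * Q z + P z * b) z := by
  have := HasDerivAt.mul h h'
  simp only [zero_smul, add_zero] at this
  exact this

theorem HasJD.div (h : HasJD v P a z) (h' : HasJD v Q b z) (h0 : Q z ≠ 0) :
    HasJD v (fun z => P z / Q z) ((a * Q z - P z * b) / Q z ^ 2) z := by
  have := HasDerivAt.div h h' (by simpa using h0)
  simp only [zero_smul, add_zero] at this
  exact this

theorem totalT_eq (F : ℝ × ℝ × ℝ → ℝ) (z : Jet1) :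
    totalT F z = ∂ₜ F (basePoint z) + z.2.2.2.1 * ∂ᵤ F (basePoint z) := by
  simp [totalT, fderiv_apply_eq, basePoint]

theorem totalX_eq (F : ℝ × ℝ × ℝ → ℝ) (z : Jet1) :
    totalX F z = ∂ₓ F (basePoint z) + z.2.2.2.2 * ∂ᵤ F (basePoint z) := by
  simp [totalX, fderiv_apply_eq, basePoint]

theorem differentiableAt_comp_basePoint (h : DifferentiableAt ℝ F (basePoint z)) :
    DifferentiableAt ℝ (fun z => F (basePoint z)) z := by
  have : DifferentiableAt ℝ basePoint z := by unfold basePoint; fun_prop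
  exact DifferentiableAt.comp z h this

theorem differentiableAt_totalT (hΩ : IsOpen Ω) (h : ContDiffOn ℝ ∞ F Ω)
    (hz : basePoint z ∈ Ω) : DifferentiableAt ℝ (totalT F) z := by
  have h1 := differentiableAt_comp_basePoint
    (differentiableAt_of_smooth hΩ (smooth_pd hΩ h et) hz)
  have h2 := differentiableAt_comp_basePoint
    (differentiableAt_of_smooth hΩ (smooth_pd hΩ h eu) hz)
  rw [funext (totalT_eq F)]
  fun_prop

theorem differentiableAt_totalX (hΩ : IsOpen Ω) (h : ContDiffOn ℝ ∞ F Ω)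
    (hz : basePoint z ∈ Ω) : DifferentiableAt ℝ (totalX F) z := by
  have h1 := differentiableAt_comp_basePoint
    (differentiableAt_of_smooth hΩ (smooth_pd hΩ h ex) hz)
  have h2 := differentiableAt_comp_basePoint
    (differentiableAt_of_smooth hΩ (smooth_pd hΩ h eu) hz)
  rw [funext (totalX_eq F)]
  fun_prop

theorem hasJD_comp_basePoint (hΩ : IsOpen Ω) (h : ContDiffOn ℝ ∞ F Ω) (hz : basePoint z ∈ Ω) :
    HasJD v (fun z => F (basePoint z)) (fderiv ℝ F (basePoint z) (basePoint v)) z :=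
  hasPD_of_smooth hΩ h hz (basePoint v)

theorem hasJD_ut : HasJD v (fun z => z.2.2.2.1) v.2.2.2.1 z := by
  simpa [HasJD] using ((hasDerivAt_id (0 : ℝ)).mul_const v.2.2.2.1).const_add z.2.2.2.1

theorem hasJD_ux : HasJD v (fun z => z.2.2.2.2) v.2.2.2.2 z := by
  simpa [HasJD] using ((hasDerivAt_id (0 : ℝ)).mul_const v.2.2.2.2).const_add z.2.2.2.2

theorem hasJD_totalT (hΩ : IsOpen Ω) (h : ContDiffOn ℝ ∞ F Ω) (hz : basePoint z ∈ Ω) :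
    HasJD v (totalT F) (fderiv ℝ (∂ₜ F) (basePoint z) (basePoint v) +
      (v.2.2.2.1 * ∂ᵤ F (basePoint z) +
        z.2.2.2.1 * fderiv ℝ (∂ᵤ F) (basePoint z) (basePoint v))) z := by
  rw [funext (totalT_eq F)]
  exact HasDerivAt.add (hasJD_comp_basePoint hΩ (smooth_pd hΩ h _) hz)
    (hasJD_ut.mul (hasJD_comp_basePoint hΩ (smooth_pd hΩ h _) hz))

theorem hasJD_totalX (hΩ : IsOpen Ω) (h : ContDiffOn ℝ ∞ F Ω) (hz : basePoint z ∈ Ω) :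
    HasJD v (totalX F) (fderiv ℝ (∂ₓ F) (basePoint z) (basePoint v) +
      (v.2.2.2.2 * ∂ᵤ F (basePoint z) +
        z.2.2.2.2 * fderiv ℝ (∂ᵤ F) (basePoint z) (basePoint v))) z := by
  rw [funext (totalX_eq F)]
  exact HasDerivAt.add (hasJD_comp_basePoint hΩ (smooth_pd hΩ h _) hz)
    (hasJD_ux.mul (hasJD_comp_basePoint hΩ (smooth_pd hΩ h _) hz))

theorem jacobian_eq (Φ : ℝ × ℝ × ℝ → ℝ × ℝ × ℝ) (p : ℝ × ℝ × ℝ) :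
    jacobian Φ p =
      ∂ᵤ (compU Φ) p * (∂ₜ (compT Φ) p * ∂ₓ (compX Φ) p - ∂ₓ (compT Φ) p * ∂ₜ (compX Φ) p)
      - ∂ₓ (compU Φ) p * (∂ₜ (compT Φ) p * ∂ᵤ (compX Φ) p - ∂ᵤ (compT Φ) p * ∂ₜ (compX Φ) p)
      + ∂ₜ (compU Φ) p * (∂ₓ (compT Φ) p * ∂ᵤ (compX Φ) p - ∂ᵤ (compT Φ) p * ∂ₓ (compX Φ) p) := by
  simp only [jacobian, Matrix.det_fin_three, pd, et, ex, eu, Matrix.of_apply, Matrix.cons_val',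
    Matrix.cons_val,
    Matrix.cons_val_zero, Matrix.cons_val_one]
  ring

theorem differentiableAt_prolongUx (hz : basePoint z ∈ Ω) (hD : baseJacobian Φ z ≠ 0)
    (hΩ : IsOpen Ω) (hT : ContDiffOn ℝ ∞ (compT Φ) Ω) (hX : ContDiffOn ℝ ∞ (compX Φ) Ω)
    (hU : ContDiffOn ℝ ∞ (compU Φ) Ω) :
    DifferentiableAt ℝ (prolongUx Φ) z := by
  have h1 := differentiableAt_totalT hΩ hT hz
  have h2 := differentiableAt_totalX hΩ hT hz
  have h3 := differentiableAt_totalT hΩ hX hz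
  have h4 := differentiableAt_totalX hΩ hX hz
  have h5 := differentiableAt_totalT hΩ hU hz
  have h6 := differentiableAt_totalX hΩ hU hz
  have hd : DifferentiableAt ℝ (baseJacobian Φ) z := (h1.mul h4).sub (h2.mul h3)
  unfold prolongUx newX
  fun_prop (disch := exact hD)

/-- The derivative of the new `u_x` with respect to the old `u_t`. -/
theorem fderiv_prolongUx_ut (hz : basePoint z ∈ Ω) (hD : baseJacobian Φ z ≠ 0)
    (hΩ : IsOpen Ω) (hT : ContDiffOn ℝ ∞ (compT Φ) Ω) (hX : ContDiffOn ℝ ∞ (compX Φ) Ω)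
    (hU : ContDiffOn ℝ ∞ (compU Φ) Ω) :
    fderiv ℝ (prolongUx Φ) z (0, 0, 0, 1, 0) =
      -(totalX (compT Φ) z * jacobian Φ (basePoint z)) / baseJacobian Φ z ^ 2 := by
  have hb : basePoint ((0, 0, 0, 1, 0) : Jet1) = 0 := rfl
  have hv (F) (h : ContDiffOn ℝ ∞ F Ω) :
      HasJD (0, 0, 0, 1, 0) (totalT F) (∂ᵤ F (basePoint z)) z ∧
        HasJD (0, 0, 0, 1, 0) (totalX F) 0 z := by
    have h1 := hasJD_totalT (v := (0, 0, 0, 1, 0)) hΩ h hz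
    have h2 := hasJD_totalX (v := (0, 0, 0, 1, 0)) hΩ h hz
    simp only [hb, map_zero, mul_zero, zero_mul, one_mul, add_zero, zero_add] at h1 h2
    exact ⟨h1, h2⟩
  obtain ⟨h1, h2⟩ := hv _ hT
  obtain ⟨h3, h4⟩ := hv _ hX
  obtain ⟨h5, h6⟩ := hv _ hU
  have := HasJD.div ((h1.mul h6).sub (h2.mul h5)) ((h1.mul h4).sub (h2.mul h3)) hD
  refine (HasJD.fderiv_eq this (differentiableAt_prolongUx hz hD hΩ hT hX hU)).trans ?_
  rw [show baseJacobian Φ z = totalT (compT Φ) z * totalX (compX Φ) z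
    - totalX (compT Φ) z * totalT (compX Φ) z from rfl]
  -- The quotient rule produces `D_x T` times the determinant of the rows `(D_t F, D_x F, F_u)`, up
  -- to sign. Total derivatives differ from partial ones by multiples of the last column, so this
  -- determinant is the Jacobian.
  congr 1
  rw [jacobian_eq]
  simp only [totalT_eq, totalX_eq]
  ring

/-- A 1-jet over the manifold of an equation lifts to it with any second derivatives `u_tt`,
`u_tx`. -/
theorem lift_mem_manifold (E : Eqn) {t x u ut ux : ℝ} (h : (t, x, u) ∈ E.domain) (utt utx : ℝ) :
    (⟨t, x, u, ut, ux, utt, utx, (ut + E.a * (E.n * u ^ (E.n - 1) * ux)) / E.g t⟩ : Jet2)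
      ∈ E.manifold := by
  refine ⟨h, ?_⟩
  have := E.g_ne_zero t h.1
  simp only
  field_simp

/-- The region where the first affine function is nonzero contains points with two different values
of `s`, and an affine function of `s` with two zeros vanishes. It is applied with `r = u_t`, `s =
u_x`, the base Jacobian as the first function and `D_x T` as the second. -/
theorem affine_eq_zero_of_ne {c₀ c₁ c₂ k₀ k₁ : ℝ} (hc : ¬ (c₀ = 0 ∧ c₁ = 0 ∧ c₂ = 0))
    (h : ∀ r s : ℝ, c₀ + r * c₁ + s * c₂ ≠ 0 → k₀ + s * k₁ = 0) : k₀ = 0 ∧ k₁ = 0 := by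
  have key : ∃ r s r' s', s ≠ s' ∧ c₀ + r * c₁ + s * c₂ ≠ 0 ∧ c₀ + r' * c₁ + s' * c₂ ≠ 0 := by
    by_cases h1 : c₁ = 0
    · by_cases h2 : c₂ = 0
      · exact ⟨0, 0, 0, 1, by norm_num, by simp_all, by simp_all⟩
      · refine ⟨0, (1 - c₀) / c₂, 0, (2 - c₀) / c₂, ?_, ?_, ?_⟩
        · intro e
          field_simp at e
          linarith
        · field_simp
          norm_num
        · field_simp
          norm_num
    · refine ⟨(1 - c₀) / c₁, 0, (1 - c₀ - c₂) / c₁, 1, by norm_num, ?_, ?_⟩ <;>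
      · rw [div_mul_cancel₀ _ h1]
        ring_nf
        exact one_ne_zero
  obtain ⟨r, s, r', s', hs, h1, h2⟩ := key
  have e1 := h r s h1
  have e2 := h r' s' h2
  have hk : k₁ = 0 := by
    have : (s - s') * k₁ = 0 := by linear_combination e1 - e2
    exact (mul_eq_zero.1 this).resolve_left (sub_ne_zero.2 hs)
  exact ⟨by simpa [hk] using e1, hk⟩

theorem smooth_compT (h : ContDiffOn ℝ ∞ Φ Ω) : ContDiffOn ℝ ∞ (compT Φ) Ω := h.fst
theorem smooth_compX (h : ContDiffOn ℝ ∞ Φ Ω) : ContDiffOn ℝ ∞ (compX Φ) Ω := h.snd.fst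
theorem smooth_compU (h : ContDiffOn ℝ ∞ Φ Ω) : ContDiffOn ℝ ∞ (compU Φ) Ω := h.snd.snd

/-- A point transformation between two equations of the class transforms `t` on its own. -/
theorem Connects.pd_compT_eq_zero {E E' : Eqn} (hΩ : IsOpen Ω) (hE : Ω ⊆ E.domain)
    (h : Connects Φ Ω E E') {p : ℝ × ℝ × ℝ} (hp : p ∈ Ω) :
    ∂ₓ (compT Φ) p = 0 ∧ ∂ᵤ (compT Φ) p = 0 := by
  obtain ⟨⟨hs, hJ⟩, hm⟩ := h
  have hT := smooth_compT hs
  have hX := smooth_compX hs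
  have hU := smooth_compU hs
  obtain ⟨t, x, u⟩ := p
  set p : ℝ × ℝ × ℝ := (t, x, u) with hpdef
  have hJp := hJ p hp
  rw [jacobian_eq] at hJp
  refine affine_eq_zero_of_ne
    (c₀ := ∂ₜ (compT Φ) p * ∂ₓ (compX Φ) p - ∂ₓ (compT Φ) p * ∂ₜ (compX Φ) p)
    (c₁ := ∂ᵤ (compT Φ) p * ∂ₓ (compX Φ) p - ∂ₓ (compT Φ) p * ∂ᵤ (compX Φ) p)
    (c₂ := ∂ₜ (compT Φ) p * ∂ᵤ (compX Φ) p - ∂ᵤ (compT Φ) p * ∂ₜ (compX Φ) p) ?_ ?_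
  -- The coefficients of the base Jacobian are, up to sign, the minors of the rows of `T` and `X`;
  -- if all vanished, so would the full Jacobian.
  · rintro ⟨h0, h1, h2⟩
    apply hJp
    linear_combination ∂ᵤ (compU Φ) p * h0 - ∂ₜ (compU Φ) p * h1 - ∂ₓ (compU Φ) p * h2
  · intro ut ux hne
    set z : Jet1 := (t, x, u, ut, ux) with hz
    have hzp : basePoint z = p := rfl
    have hD : baseJacobian Φ z ≠ 0 := by
      intro e
      apply hne
      simp only [baseJacobian, totalT_eq, totalX_eq, hzp] at e
      linear_combination e
    -- Two jets that differ only in `u_tt` both lie on the manifold of `E`. Their images share `t,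
    -- x, u, u_t, u_x`, so `E'` forces the same new `u_xx`; the difference of the two is `(D_x T)²`
    -- times the Jacobian over the cube of the base Jacobian.
    have m0 := hm _ (lift_mem_manifold E (ut := ut) (ux := ux) (hE hp) 0 0) hp hD
    have m1 := hm _ (lift_mem_manifold E (ut := ut) (ux := ux) (hE hp) 1 0) hp hD
    set c := (ut + E.a * (E.n * u ^ (E.n - 1) * ux)) / E.g t
    have hg := E'.g_ne_zero _ m0.1.1
    have e0 := m0.2
    have e1 := m1.2
    simp only [prolong, Jet2.toJet1, Jet2.point, totalT₁, totalX₁] at e0 e1 hg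
    have e2 : newX Φ z (fderiv ℝ (prolongUx Φ) z (1, 0, ut, 0, 0))
          (fderiv ℝ (prolongUx Φ) z (0, 1, ux, 0, c))
        = newX Φ z (fderiv ℝ (prolongUx Φ) z (1, 0, ut, 1, 0))
          (fderiv ℝ (prolongUx Φ) z (0, 1, ux, 0, c)) :=
      mul_left_cancel₀ hg (e0.symm.trans e1)
    have e3 : fderiv ℝ (prolongUx Φ) z (1, 0, ut, 1, 0)
        = fderiv ℝ (prolongUx Φ) z (1, 0, ut, 0, 0)
          + fderiv ℝ (prolongUx Φ) z (0, 0, 0, 1, 0) := by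
      rw [← map_add]
      simp
    rw [e3, fderiv_prolongUx_ut (z := z) (Ω := Ω) hp hD hΩ hT hX hU] at e2
    have hJz : jacobian Φ (basePoint z) ≠ 0 := hJ p hp
    unfold newX at e2
    field_simp at e2
    have e4 : totalX (compT Φ) z ^ 2 * jacobian Φ (basePoint z) = 0 := by
      linear_combination -e2
    have e5 := pow_eq_zero_iff (two_ne_zero) |>.1 ((mul_eq_zero.1 e4).resolve_right hJz)
    rw [totalX_eq] at e5
    exact e5

end

/-! ### Prolongation when `T = T(t)`, and the determining equations -/

section

variable {Ω : Set (ℝ × ℝ × ℝ)} {Φ : ℝ × ℝ × ℝ → ℝ × ℝ × ℝ} {z : Jet1} {E E' : Eqn}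

section TimePreserving

variable {t x u ut ux utt utx uxx : ℝ}

theorem jacobian_of_pd_compT_eq_zero {p : ℝ × ℝ × ℝ}
    (hT : ∂ₓ (compT Φ) p = 0 ∧ ∂ᵤ (compT Φ) p = 0) :
    jacobian Φ p = ∂ₜ (compT Φ) p *
      (∂ᵤ (compU Φ) p * ∂ₓ (compX Φ) p - ∂ₓ (compU Φ) p * ∂ᵤ (compX Φ) p) := by
  rw [jacobian_eq, hT.1, hT.2]
  ring

theorem newX_of_pd_compT_eq_zero
    (hT : ∂ₓ (compT Φ) (basePoint z) = 0 ∧ ∂ᵤ (compT Φ) (basePoint z) = 0)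
    (hT' : ∂ₜ (compT Φ) (basePoint z) ≠ 0) (a b : ℝ) :
    newX Φ z a b = b / totalX (compX Φ) z := by
  simp only [newX, baseJacobian, totalT_eq (compT Φ), totalX_eq (compT Φ), hT.1, hT.2, mul_zero,
    add_zero, zero_mul, sub_zero]
  rw [mul_div_mul_left _ _ hT']

theorem baseJacobian_of_pd_compT_eq_zero
    (hT : ∂ₓ (compT Φ) (basePoint z) = 0 ∧ ∂ᵤ (compT Φ) (basePoint z) = 0) :
    baseJacobian Φ z = ∂ₜ (compT Φ) (basePoint z) * totalX (compX Φ) z := by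
  simp only [baseJacobian, totalT_eq (compT Φ), totalX_eq (compT Φ), hT.1, hT.2, mul_zero,
    add_zero, zero_mul, sub_zero]

theorem prolong_uxx_of_pd_compT_eq_zero (hΩ : IsOpen Ω)
    (hX : ContDiffOn ℝ ∞ (compX Φ) Ω) (hU : ContDiffOn ℝ ∞ (compU Φ) Ω)
    (hT : ∀ p ∈ Ω, ∂ₓ (compT Φ) p = 0 ∧ ∂ᵤ (compT Φ) p = 0)
    (hT' : ∀ p ∈ Ω, ∂ₜ (compT Φ) p ≠ 0) {p : ℝ × ℝ × ℝ} (hpe : p = (t, x, u)) (hp : p ∈ Ω)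
    (hw : ∂ₓ (compX Φ) p + ux * ∂ᵤ (compX Φ) p ≠ 0) :
    (prolong Φ ⟨t, x, u, ut, ux, utt, utx, uxx⟩).uxx =
      ((∂ₓ (∂ₓ (compU Φ)) p + 2 * ux * ∂ₓ (∂ᵤ (compU Φ)) p + ux ^ 2 * ∂ᵤ (∂ᵤ (compU Φ)) p
          + uxx * ∂ᵤ (compU Φ) p) * (∂ₓ (compX Φ) p + ux * ∂ᵤ (compX Φ) p)
        - (∂ₓ (compU Φ) p + ux * ∂ᵤ (compU Φ) p) *
          (∂ₓ (∂ₓ (compX Φ)) p + 2 * ux * ∂ₓ (∂ᵤ (compX Φ)) p + ux ^ 2 * ∂ᵤ (∂ᵤ (compX Φ)) p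
            + uxx * ∂ᵤ (compX Φ) p)) / (∂ₓ (compX Φ) p + ux * ∂ᵤ (compX Φ) p) ^ 3 := by
  subst hpe
  set z : Jet1 := (t, x, u, ut, ux) with hz
  have hzp : basePoint z = (t, x, u) := rfl
  have hw' : totalX (compX Φ) z ≠ 0 := by rw [totalX_eq]; exact hw
  -- The simplified form of the new `u_x` is needed near `z`, not only at `z`, because it is
  -- differentiated next.
  have hev : prolongUx Φ =ᶠ[nhds z] fun z => totalX (compU Φ) z / totalX (compX Φ) z := by
    have hc : ContinuousAt basePoint z := by unfold basePoint; fun_prop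
    filter_upwards [hc (hΩ.mem_nhds hp)] with y hy
    exact newX_of_pd_compT_eq_zero (hT _ hy) (hT' _ hy) _ _
  have h1 := hasJD_totalX (z := z) (v := (0, 1, ux, utx, uxx)) hΩ hU hp
  have h2 := hasJD_totalX (z := z) (v := (0, 1, ux, utx, uxx)) hΩ hX hp
  have hd1 := differentiableAt_totalX (z := z) hΩ hU hp
  have hd2 := differentiableAt_totalX (z := z) hΩ hX hp
  have hd : DifferentiableAt ℝ (fun z => totalX (compU Φ) z / totalX (compX Φ) z) z := by
    fun_prop (disch := exact hw')
  have h3 := (h1.div h2 hw').fderiv_eq hd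
  have h4 : (prolong Φ ⟨t, x, u, ut, ux, utt, utx, uxx⟩).uxx =
      fderiv ℝ (prolongUx Φ) z (0, 1, ux, utx, uxx) / totalX (compX Φ) z :=
    newX_of_pd_compT_eq_zero (z := z) (hT _ hp) (hT' _ hp) _ _
  rw [h4, hev.fderiv_eq, h3]
  have hb : basePoint (0, 1, ux, utx, uxx) = (0, 1, ux) := rfl
  simp only [hb, fderiv_apply_eq, totalX_eq, hzp]
  rw [pd_comm hΩ hU hp eu ex, pd_comm hΩ hX hp eu ex]
  simp only [hz]
  field_simp
  ring

theorem prolongUx_of_pd_compT_eq_zero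
    (hT : ∂ₓ (compT Φ) (basePoint z) = 0 ∧ ∂ᵤ (compT Φ) (basePoint z) = 0)
    (hT' : ∂ₜ (compT Φ) (basePoint z) ≠ 0) :
    prolongUx Φ z = totalX (compU Φ) z / totalX (compX Φ) z :=
  newX_of_pd_compT_eq_zero hT hT' _ _

theorem prolongUt_of_pd_compT_eq_zero
    (hT : ∂ₓ (compT Φ) (basePoint z) = 0 ∧ ∂ᵤ (compT Φ) (basePoint z) = 0) :
    prolongUt Φ z = (totalX (compX Φ) z * totalT (compU Φ) z
      - totalT (compX Φ) z * totalX (compU Φ) z) /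
        (∂ₜ (compT Φ) (basePoint z) * totalX (compX Φ) z) := by
  rw [prolongUt, newT, baseJacobian_of_pd_compT_eq_zero hT]

end TimePreserving

/-- The determining equations for the components `T`, `X`, `U` of a point transformation that
connects `E` with `E'`. -/
structure DeterminingEqs (E E' : Eqn) (T X U : ℝ × ℝ × ℝ → ℝ) (Ω : Set (ℝ × ℝ × ℝ)) : Prop where
  smooth_T : ContDiffOn ℝ ∞ T Ω
  smooth_X : ContDiffOn ℝ ∞ X Ω
  smooth_U : ContDiffOn ℝ ∞ U Ω
  T_x : ∀ p ∈ Ω, ∂ₓ T p = 0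
  T_u : ∀ p ∈ Ω, ∂ᵤ T p = 0
  T_t : ∀ p ∈ Ω, ∂ₜ T p ≠ 0
  X_u : ∀ p ∈ Ω, ∂ᵤ X p = 0
  X_x : ∀ p ∈ Ω, ∂ₓ X p ≠ 0
  U_u : ∀ p ∈ Ω, ∂ᵤ U p ≠ 0
  diffusion : ∀ p ∈ Ω, ∂ₓ X p * ∂ₓ X p * E.g p.1 = ∂ₜ T p * E'.g (T p)
  U_uu : ∀ p ∈ Ω, ∂ᵤ (∂ᵤ U) p = 0
  linear : ∀ p ∈ Ω, ∂ₜ T p * (E'.a * E'.n * U p ^ (E'.n - 1)) * ∂ᵤ U p - ∂ₜ X p * ∂ᵤ U p =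
    ∂ₓ X p * (2 * E.g p.1 * ∂ₓ (∂ᵤ U) p + E.a * E.n * p.2.2 ^ (E.n - 1) * ∂ᵤ U p)
  free : ∀ p ∈ Ω, ∂ₜ U p * ∂ₓ X p - ∂ₜ X p * ∂ₓ U p
    + ∂ₜ T p * (E'.a * E'.n * U p ^ (E'.n - 1)) * ∂ₓ U p = E.g p.1 * ∂ₓ X p * ∂ₓ (∂ₓ U) p

theorem Eqn.hasDerivAt_g (E : Eqn) {t : ℝ} (ht : t ∈ E.I) : HasDerivAt E.g (deriv E.g t) t :=
  ((E.smooth_g.contDiffAt (E.isOpen_I.mem_nhds ht)).differentiableAt (by simp)).hasDerivAt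

/-- The diffusion coefficients force `X` to be affine in `x`. -/
theorem X_xx_eq_zero {T X : ℝ × ℝ × ℝ → ℝ} (hΩ : IsOpen Ω)
    (hT : ContDiffOn ℝ ∞ T Ω) (hX : ContDiffOn ℝ ∞ X Ω)
    (hE : Ω ⊆ E.domain) (hE' : ∀ p ∈ Ω, T p ∈ E'.I)
    (hTx : ∀ p ∈ Ω, ∂ₓ T p = 0) (hXx : ∀ p ∈ Ω, ∂ₓ X p ≠ 0)
    (h : ∀ p ∈ Ω, ∂ₓ X p * ∂ₓ X p * E.g p.1 = ∂ₜ T p * E'.g (T p)) :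
    ∀ p ∈ Ω, ∂ₓ (∂ₓ X) p = 0 := by
  intro p hp
  have h1 := hasPD_of_smooth hΩ (smooth_pd hΩ hX ex) hp ex
  have h2 := HasPD.comp (E.hasDerivAt_g (hE hp).1) (hasPD_t (v := ex) (p := p))
  have h3 := hasPD_of_smooth hΩ (smooth_pd hΩ hT et) hp ex
  have h4 := HasPD.comp (E'.hasDerivAt_g (hE' p hp)) (hasPD_of_smooth hΩ hT hp ex)
  -- Along `x`, only `X_x²` varies in the diffusion relation, which leaves `2 X_x X_xx g = 0`.
  have e := HasPD.eq_of_eqOn hΩ hp h ((h1.mul h1).mul h2) (h3.mul h4)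
  rw [pd_comm hΩ hT hp, pd_eq_zero_of_eqOn hΩ hp hTx, hTx p hp] at e
  simp only [ex_components, mul_zero, zero_mul, add_zero] at e
  have hg := E.g_ne_zero _ (hE hp).1
  have : ∂ₓ X p * E.g p.1 * ∂ₓ (∂ₓ X) p * 2 = 0 := by
    linear_combination e
  simpa [hg, hXx p hp] using this

/-- The letters stand for values at one point; `g'` is the diffusion coefficient of the second
equation, and `A`, `B` are the factors of `u_x` in the two equations. Comparing `u_t = 0` with `u_t
= 1` gives `(D_x X)² g = T_t g'` wherever `D_x X ≠ 0`. If `X_u ≠ 0`, then `D_x X` takes the values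
`1` and `2`, so `g = 4 g`, which is impossible. -/
theorem X_u_eq_zero_of_forall {Ut Ux Uu Uxx Uxu Uuu Xt Xx Xu Xxx Xxu Xuu Tt A B g g' : ℝ}
    (hK : Uu * Xx - Ux * Xu ≠ 0) (hTt : Tt ≠ 0) (hg : g ≠ 0)
    (h : ∀ ut ux, Xx + ux * Xu ≠ 0 →
      ((Xx + ux * Xu) * (Ut + ut * Uu) - (Xt + ut * Xu) * (Ux + ux * Uu)) / (Tt * (Xx + ux * Xu))
        + B * ((Ux + ux * Uu) / (Xx + ux * Xu)) =
      g' * (((Uxx + 2 * ux * Uxu + ux ^ 2 * Uuu + (ut + A * ux) / g * Uu) * (Xx + ux * Xu)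
        - (Ux + ux * Uu) * (Xxx + 2 * ux * Xxu + ux ^ 2 * Xuu + (ut + A * ux) / g * Xu))
          / (Xx + ux * Xu) ^ 3)) :
    Xu = 0 ∧ Xx * Xx * g = Tt * g' := by
  have key : ∀ ux, Xx + ux * Xu ≠ 0 → (Xx + ux * Xu) * (Xx + ux * Xu) * g = Tt * g' := by
    intro ux hw
    have h0 := h 0 ux hw
    have h1 := h 1 ux hw
    field_simp at h0 h1
    have : (Uu * Xx - Ux * Xu) * ((Xx + ux * Xu) * (Xx + ux * Xu) * g - Tt * g') = 0 := by
      linear_combination h1 - h0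
    exact sub_eq_zero.1 ((mul_eq_zero.1 this).resolve_left hK)
  have hXu : Xu = 0 := by
    by_contra hne
    have e1 : Xx + (1 - Xx) / Xu * Xu = 1 := by field_simp; ring
    have e2 : Xx + (2 - Xx) / Xu * Xu = 2 := by field_simp; ring
    have k1 := key ((1 - Xx) / Xu) (by rw [e1]; norm_num)
    have k2 := key ((2 - Xx) / Xu) (by rw [e2]; norm_num)
    rw [e1] at k1
    rw [e2] at k2
    apply hg
    linarith
  refine ⟨hXu, ?_⟩
  have hXx : Xx ≠ 0 := by
    rintro rfl
    simp [hXu] at hK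
  simpa using key 0 (by simpa using hXx)

/-- By `hgg` the terms with `u_t` cancel, and clearing denominators leaves a quadratic polynomial in
`u_x`. Its coefficients are recovered from the values at `0`, `1`, `-1`. -/
theorem determining_of_forall {Ut Ux Uu Uxx Uxu Uuu Xt Xx Tt A B g g' : ℝ}
    (hXx : Xx ≠ 0) (hTt : Tt ≠ 0) (hg : g ≠ 0) (hgg : Xx * Xx * g = Tt * g') :
    (∀ ut ux,
      (Xx * (Ut + ut * Uu) - Xt * (Ux + ux * Uu)) / (Tt * Xx) + B * ((Ux + ux * Uu) / Xx) =
      g' * (((Uxx + 2 * ux * Uxu + ux ^ 2 * Uuu + (ut + A * ux) / g * Uu) * Xx) / Xx ^ 3)) ↔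
    Uuu = 0 ∧ Tt * B * Uu - Xt * Uu = Xx * (2 * g * Uxu + A * Uu) ∧
      Ut * Xx - Xt * Ux + Tt * B * Ux = g * Xx * Uxx := by
  have hg' : g' = Xx * Xx * g / Tt := by field_simp; linear_combination -hgg
  have key : ∀ ut ux, ((Xx * (Ut + ut * Uu) - Xt * (Ux + ux * Uu)) / (Tt * Xx)
        + B * ((Ux + ux * Uu) / Xx) =
      g' * (((Uxx + 2 * ux * Uxu + ux ^ 2 * Uuu + (ut + A * ux) / g * Uu) * Xx) / Xx ^ 3)) ↔
      (Ut * Xx - Xt * Ux + Tt * B * Ux - g * Xx * Uxx)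
        + ux * (Tt * B * Uu - Xt * Uu - Xx * (2 * g * Uxu + A * Uu))
        - ux ^ 2 * (g * Xx * Uuu) = 0 := by
    intro ut ux
    rw [hg']
    field_simp
    constructor <;> intro h <;> linear_combination h
  simp only [key]
  constructor
  · intro h
    have h0 := h 0 0
    have h1 := h 0 1
    have h2 := h 0 (-1)
    have h3 : g * Xx * Uuu = 0 := by linear_combination h0 - h1 / 2 - h2 / 2
    refine ⟨by simpa [hg, hXx] using h3, ?_, ?_⟩
    · linear_combination (h1 - h2) / 2
    · linear_combination h0
  · rintro ⟨h1, h2, h3⟩ ut ux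
    rw [h1]
    linear_combination h3 + ux * h2

/-- The bridge from jets to differential equations on `Ω`. The condition `X_xx = 0` is not a field
of `DeterminingEqs`, since `diffusion` implies it through `X_xx_eq_zero`; it is recovered in both
directions. -/
theorem connects_iff_determiningEqs (hΩ : IsOpen Ω) (hE : Ω ⊆ E.domain)
    (hΦ : MapsTo Φ Ω E'.domain) :
    Connects Φ Ω E E' ↔ DeterminingEqs E E' (compT Φ) (compX Φ) (compU Φ) Ω := by
  constructor
  · intro h
    have hT0 : ∀ p ∈ Ω, ∂ₓ (compT Φ) p = 0 ∧ ∂ᵤ (compT Φ) p = 0 := fun p hp =>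
      h.pd_compT_eq_zero hΩ hE hp
    obtain ⟨⟨hs, hJ⟩, hm⟩ := h
    have hT := smooth_compT hs
    have hX := smooth_compX hs
    have hU := smooth_compU hs
    have hJ' : ∀ p ∈ Ω, ∂ₜ (compT Φ) p ≠ 0 ∧
        ∂ᵤ (compU Φ) p * ∂ₓ (compX Φ) p - ∂ₓ (compU Φ) p * ∂ᵤ (compX Φ) p ≠ 0 := by
      intro p hp
      have := hJ p hp
      rw [jacobian_of_pd_compT_eq_zero (hT0 p hp)] at this
      exact mul_ne_zero_iff.1 this
    have main : ∀ p ∈ Ω, ∀ ut ux : ℝ, ∂ₓ (compX Φ) p + ux * ∂ᵤ (compX Φ) p ≠ 0 →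
        ((∂ₓ (compX Φ) p + ux * ∂ᵤ (compX Φ) p) * (∂ₜ (compU Φ) p + ut * ∂ᵤ (compU Φ) p)
          - (∂ₜ (compX Φ) p + ut * ∂ᵤ (compX Φ) p) * (∂ₓ (compU Φ) p + ux * ∂ᵤ (compU Φ) p))
            / (∂ₜ (compT Φ) p * (∂ₓ (compX Φ) p + ux * ∂ᵤ (compX Φ) p))
          + E'.a * E'.n * compU Φ p ^ (E'.n - 1) *
            ((∂ₓ (compU Φ) p + ux * ∂ᵤ (compU Φ) p) / (∂ₓ (compX Φ) p + ux * ∂ᵤ (compX Φ) p)) =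
        E'.g (compT Φ p) *
          (((∂ₓ (∂ₓ (compU Φ)) p + 2 * ux * ∂ₓ (∂ᵤ (compU Φ)) p + ux ^ 2 * ∂ᵤ (∂ᵤ (compU Φ)) p
              + (ut + E.a * E.n * p.2.2 ^ (E.n - 1) * ux) / E.g p.1 * ∂ᵤ (compU Φ) p)
              * (∂ₓ (compX Φ) p + ux * ∂ᵤ (compX Φ) p)
            - (∂ₓ (compU Φ) p + ux * ∂ᵤ (compU Φ) p) *
              (∂ₓ (∂ₓ (compX Φ)) p + 2 * ux * ∂ₓ (∂ᵤ (compX Φ)) p + ux ^ 2 * ∂ᵤ (∂ᵤ (compX Φ)) p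
                + (ut + E.a * E.n * p.2.2 ^ (E.n - 1) * ux) / E.g p.1 * ∂ᵤ (compX Φ) p))
            / (∂ₓ (compX Φ) p + ux * ∂ᵤ (compX Φ) p) ^ 3) := by
      intro p hp ut ux hw
      have hw' : baseJacobian Φ (p.1, p.2.1, p.2.2, ut, ux) ≠ 0 := by
        rw [baseJacobian_of_pd_compT_eq_zero (hT0 p hp), totalX_eq]
        exact mul_ne_zero (hJ' p hp).1 hw
      have m := (hm _ (lift_mem_manifold E (ut := ut) (ux := ux) (hE hp) 0 0) hp hw').2
      rw [prolong_uxx_of_pd_compT_eq_zero hΩ hX hU hT0 (fun p hp => (hJ' p hp).1) rfl hp hw] at m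
      simp only [prolong, Jet2.toJet1] at m
      rw [prolongUx_of_pd_compT_eq_zero (hT0 p hp) (hJ' p hp).1,
        prolongUt_of_pd_compT_eq_zero (hT0 p hp)] at m
      simp only [totalT_eq, totalX_eq, basePoint, Jet2.point, ← mul_assoc] at m
      exact m
    have step : ∀ p ∈ Ω, ∂ᵤ (compX Φ) p = 0 ∧
        ∂ₓ (compX Φ) p * ∂ₓ (compX Φ) p * E.g p.1 = ∂ₜ (compT Φ) p * E'.g (compT Φ p) :=
      fun p hp => X_u_eq_zero_of_forall (hJ' p hp).2 (hJ' p hp).1 (E.g_ne_zero _ (hE hp).1)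
        (main p hp)
    have hne : ∀ p ∈ Ω, ∂ᵤ (compU Φ) p ≠ 0 ∧ ∂ₓ (compX Φ) p ≠ 0 := by
      intro p hp
      have := (hJ' p hp).2
      rw [(step p hp).1, mul_zero, sub_zero] at this
      exact mul_ne_zero_iff.1 this
    have hXxx := X_xx_eq_zero hΩ hT hX hE (fun p hp => (hΦ hp).1) (fun p hp => (hT0 p hp).1)
      (fun p hp => (hne p hp).2) (fun p hp => (step p hp).2)
    have hdet : ∀ p ∈ Ω, ∂ᵤ (∂ᵤ (compU Φ)) p = 0 ∧
        ∂ₜ (compT Φ) p * (E'.a * E'.n * compU Φ p ^ (E'.n - 1)) * ∂ᵤ (compU Φ) p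
          - ∂ₜ (compX Φ) p * ∂ᵤ (compU Φ) p =
        ∂ₓ (compX Φ) p * (2 * E.g p.1 * ∂ₓ (∂ᵤ (compU Φ)) p
          + E.a * E.n * p.2.2 ^ (E.n - 1) * ∂ᵤ (compU Φ) p) ∧
        ∂ₜ (compU Φ) p * ∂ₓ (compX Φ) p - ∂ₜ (compX Φ) p * ∂ₓ (compU Φ) p
          + ∂ₜ (compT Φ) p * (E'.a * E'.n * compU Φ p ^ (E'.n - 1)) * ∂ₓ (compU Φ) p =
        E.g p.1 * ∂ₓ (compX Φ) p * ∂ₓ (∂ₓ (compU Φ)) p := fun p hp =>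
      (determining_of_forall (hne p hp).2 (hJ' p hp).1 (E.g_ne_zero _ (hE hp).1)
        (step p hp).2).1 (fun ut ux => by
          have := main p hp ut ux (by simpa [(step p hp).1] using (hne p hp).2)
          rw [hXxx p hp, pd_eq_zero_of_eqOn hΩ hp (fun q hq => (step q hq).1),
            pd_eq_zero_of_eqOn hΩ hp (fun q hq => (step q hq).1), (step p hp).1] at this
          simp only [mul_zero, add_zero, sub_zero] at this
          exact this)
    exact ⟨hT, hX, hU, fun p hp => (hT0 p hp).1, fun p hp => (hT0 p hp).2,
      fun p hp => (hJ' p hp).1, fun p hp => (step p hp).1, fun p hp => (hne p hp).2,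
      fun p hp => (hne p hp).1, fun p hp => (step p hp).2, fun p hp => (hdet p hp).1,
      fun p hp => (hdet p hp).2.1, fun p hp => (hdet p hp).2.2⟩
  · intro h
    have hT0 : ∀ p ∈ Ω, ∂ₓ (compT Φ) p = 0 ∧ ∂ᵤ (compT Φ) p = 0 := fun p hp =>
      ⟨h.T_x p hp, h.T_u p hp⟩
    have hXxx := X_xx_eq_zero hΩ h.smooth_T h.smooth_X hE (fun p hp => (hΦ hp).1) h.T_x h.X_x
      h.diffusion
    refine ⟨⟨h.smooth_T.prodMk (h.smooth_X.prodMk h.smooth_U), ?_⟩, ?_⟩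
    · intro p hp
      rw [jacobian_of_pd_compT_eq_zero (hT0 p hp), h.X_u p hp, mul_zero, sub_zero]
      exact mul_ne_zero (h.T_t p hp) (mul_ne_zero (h.U_u p hp) (h.X_x p hp))
    · rintro ⟨t, x, u, ut, ux, utt, utx, uxx⟩ hj hp -
      refine ⟨hΦ hp, ?_⟩
      replace hp : (t, x, u) ∈ Ω := hp
      have hg := E.g_ne_zero t hj.1.1
      have hj2 : uxx = (ut + E.a * E.n * u ^ (E.n - 1) * ux) / E.g t := by
        have := hj.2
        simp only at this
        field_simp
        linear_combination -this
      have hw : ∂ₓ (compX Φ) (t, x, u) + ux * ∂ᵤ (compX Φ) (t, x, u) ≠ 0 := by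
        simpa [h.X_u _ hp] using h.X_x _ hp
      rw [prolong_uxx_of_pd_compT_eq_zero hΩ h.smooth_X h.smooth_U hT0 h.T_t rfl hp hw]
      simp only [prolong, Jet2.toJet1]
      rw [prolongUx_of_pd_compT_eq_zero (z := (t, x, u, ut, ux)) (hT0 _ hp) (h.T_t _ hp),
        prolongUt_of_pd_compT_eq_zero (z := (t, x, u, ut, ux)) (hT0 _ hp)]
      simp only [totalT_eq, totalX_eq, basePoint, Jet2.point, ← mul_assoc]
      rw [hXxx _ hp, pd_eq_zero_of_eqOn hΩ hp h.X_u, pd_eq_zero_of_eqOn hΩ hp h.X_u, h.X_u _ hp]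
      simp only [mul_zero, add_zero, sub_zero]
      rw [hj2]
      exact (determining_of_forall (h.X_x _ hp) (h.T_t _ hp) hg (h.diffusion _ hp)).2
        ⟨h.U_uu _ hp, h.linear _ hp, h.free _ hp⟩ ut ux

end

/-! ### Equality of the exponents, and the case `n ≠ 2` -/

section

variable {Ω : Set (ℝ × ℝ × ℝ)} {T X U : ℝ × ℝ × ℝ → ℝ} {E E' : Eqn}

/-- This is the condition under which `u ^ (n - 1)` is differentiable. A point `u = 0` is allowed
only for natural `n`, and then `n ≥ 2` because `0` and `1` are excluded. -/
theorem Eqn.ne_zero_or_one_le (E : Eqn) {u : ℝ} (hu : u ∈ powDomain E.n) :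
    u ≠ 0 ∨ 1 ≤ E.n - 1 := by
  rcases hu with h | ⟨-, h⟩ | ⟨k, hk⟩
  · exact Or.inl h.ne'
  · exact Or.inl h
  · right
    have h0 : k ≠ 0 := fun e => E.n_ne_zero (by simp [hk, e])
    have h1 : k ≠ 1 := fun e => E.n_ne_one (by simp [hk, e])
    have h2 : 2 ≤ k := by omega
    have : (2 : ℝ) ≤ k := by exact_mod_cast h2
    rw [hk]
    linarith

/-- A real power of a negative number may vanish for a non-integer exponent, but negative `u` are
allowed only for integer `n`, where the power is an integer one. -/
theorem rpow_ne_zero_of_mem_powDomain {n u : ℝ} (hu : u ∈ powDomain n) (h0 : u ≠ 0) :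
    u ^ (n - 1) ≠ 0 := by
  have hint (k : ℤ) (hk : n = k) : u ^ (n - 1) ≠ 0 := by
    rw [hk, show (k : ℝ) - 1 = ((k - 1 : ℤ) : ℝ) by push_cast; ring, Real.rpow_intCast]
    exact zpow_ne_zero _ h0
  rcases hu with h | ⟨⟨k, hk⟩, -⟩ | ⟨k, hk⟩
  · exact (Real.rpow_pos_of_pos h _).ne'
  · exact hint k hk
  · exact hint k (by simpa using hk)

theorem rpow_sub_one_ne_zero_of_mem_powDomain {n u : ℝ} (hu : u ∈ powDomain n) (h0 : u ≠ 0) :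
    u ^ (n - 1 - 1) ≠ 0 := by
  rw [Real.rpow_sub_one h0]
  exact div_ne_zero (rpow_ne_zero_of_mem_powDomain hu h0) h0

theorem hasPD_g (hE : Ω ⊆ E.domain) {p : ℝ × ℝ × ℝ} (hp : p ∈ Ω) (v : ℝ × ℝ × ℝ) :
    HasPD v (fun q => E.g q.1) (deriv E.g p.1 * v.1) p :=
  HasPD.comp (E.hasDerivAt_g (hE hp).1) hasPD_t

namespace DeterminingEqs

/-- The consequence of the equation `linear` that involves no `x`-derivatives of `U`. -/
theorem power_eq (h : DeterminingEqs E E' T X U Ω) (hΩ : IsOpen Ω) (hE : Ω ⊆ E.domain)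
    (hE' : ∀ p ∈ Ω, U p ∈ powDomain E'.n) : ∀ p ∈ Ω,
    ∂ₜ T p * (E'.a * E'.n * (E'.n - 1) * U p ^ (E'.n - 1 - 1)) * ∂ᵤ U p =
      ∂ₓ X p * (E.a * E.n * (E.n - 1) * p.2.2 ^ (E.n - 1 - 1)) := by
  intro p hp
  have hUu := smooth_pd hΩ h.smooth_U eu
  have dTt := hasPD_of_smooth hΩ (smooth_pd hΩ h.smooth_T et) hp eu
  have dXt := hasPD_of_smooth hΩ (smooth_pd hΩ h.smooth_X et) hp eu
  have dXx := hasPD_of_smooth hΩ (smooth_pd hΩ h.smooth_X ex) hp eu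
  have dU := hasPD_of_smooth hΩ h.smooth_U hp eu
  have dUu := hasPD_of_smooth hΩ hUu hp eu
  have dUxu := hasPD_of_smooth hΩ (smooth_pd hΩ hUu ex) hp eu
  rw [pd_pd_eq_zero hΩ h.smooth_T h.T_u et p hp] at dTt
  rw [pd_pd_eq_zero hΩ h.smooth_X h.X_u et p hp] at dXt
  rw [pd_pd_eq_zero hΩ h.smooth_X h.X_u ex p hp] at dXx
  rw [h.U_uu p hp] at dUu
  rw [pd_pd_eq_zero hΩ hUu h.U_uu ex p hp] at dUxu
  -- Along `u`, only the two powers vary; a common factor `U_u` is then cancelled.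
  have e := HasPD.eq_of_eqOn hΩ hp h.linear
    (((dTt.mul ((dU.rpow (E'.ne_zero_or_one_le (hE' p hp))).const_mul _)).mul dUu).sub
      (dXt.mul dUu))
    (dXx.mul ((((hasPD_g hE hp eu).const_mul 2).mul dUxu).add
      (((hasPD_u.rpow (E.ne_zero_or_one_le (hE hp).2)).const_mul _).mul dUu)))
  simp only [eu_components, mul_zero, zero_mul, add_zero, zero_add, sub_zero, mul_one] at e
  apply mul_right_cancel₀ (h.U_u p hp)
  linear_combination e

/-- The logarithmic `u`-derivative of `power_eq` is `(n' - 2) U_u / U = (n - 2) / u`. Clearing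
denominators and keeping the factor `u U` makes it valid where `u` or `U` vanishes. -/
theorem power_eq_ratio (h : DeterminingEqs E E' T X U Ω) (hΩ : IsOpen Ω) (hE : Ω ⊆ E.domain)
    (hE' : ∀ p ∈ Ω, U p ∈ powDomain E'.n) : ∀ p ∈ Ω,
    p.2.2 * U p * ((E'.n - 2) * (p.2.2 * ∂ᵤ U p) - (E.n - 2) * U p) = 0 := by
  intro p hp
  rcases eq_or_ne p.2.2 0 with hu | hu
  · simp [hu]
  rcases eq_or_ne (U p) 0 with hU | hU
  · simp [hU]
  have dTt := hasPD_of_smooth hΩ (smooth_pd hΩ h.smooth_T et) hp eu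
  have dXx := hasPD_of_smooth hΩ (smooth_pd hΩ h.smooth_X ex) hp eu
  have dU := hasPD_of_smooth hΩ h.smooth_U hp eu
  have dUu := hasPD_of_smooth hΩ (smooth_pd hΩ h.smooth_U eu) hp eu
  rw [pd_pd_eq_zero hΩ h.smooth_T h.T_u et p hp] at dTt
  rw [pd_pd_eq_zero hΩ h.smooth_X h.X_u ex p hp] at dXx
  rw [h.U_uu p hp] at dUu
  have e := HasPD.eq_of_eqOn hΩ hp (h.power_eq hΩ hE hE')
    ((dTt.mul ((dU.rpow (r := E'.n - 1 - 1) (Or.inl hU)).const_mul _)).mul dUu)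
    (dXx.mul ((hasPD_u.rpow (r := E.n - 1 - 1) (Or.inl hu)).const_mul _))
  have e0 := h.power_eq hΩ hE hE' p hp
  rw [Real.rpow_sub_one hU (E'.n - 1 - 1), Real.rpow_sub_one hu (E.n - 1 - 1)] at e
  have hne : ∂ₓ X p * (E.a * E.n * (E.n - 1) * p.2.2 ^ (E.n - 1 - 1)) ≠ 0 :=
    mul_ne_zero (h.X_x p hp) (mul_ne_zero (mul_ne_zero (mul_ne_zero E.a_ne_zero E.n_ne_zero)
      (sub_ne_zero.2 E.n_ne_one)) (rpow_sub_one_ne_zero_of_mem_powDomain (hE hp).2 hu))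
  refine mul_eq_zero_of_right _ ((mul_eq_zero.1 (?_ :
    ∂ₓ X p * (E.a * E.n * (E.n - 1) * p.2.2 ^ (E.n - 1 - 1)) *
      ((E'.n - 2) * (p.2.2 * ∂ᵤ U p) - (E.n - 2) * U p) = 0)).resolve_left hne)
  simp only [eu_components] at e
  field_simp at e
  linear_combination e - (E'.n - 2) * p.2.2 * ∂ᵤ U p * e0

theorem exists_u_mul_U_ne_zero (h : DeterminingEqs E E' T X U Ω) (hΩ : IsOpen Ω)
    (hne : Ω.Nonempty) : ∃ p ∈ Ω, p.2.2 * U p ≠ 0 := by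
  by_contra! hz
  obtain ⟨p, hp⟩ := hne
  have hU := eq_zero_of_u_mul_eq_zero hΩ (fun q hq => ⟨_, hasPD_of_smooth hΩ h.smooth_U hq eu⟩) hz
  exact h.U_u p hp (pd_eq_zero_of_eqOn hΩ hp hU eu)

/-- The bracket in `power_eq_ratio` vanishes where `u U ≠ 0`, and its `u`-derivative is `(n' - n)
U_u` because `U_uu = 0`. -/
theorem n_eq (h : DeterminingEqs E E' T X U Ω) (hΩ : IsOpen Ω) (hne : Ω.Nonempty)
    (hE : Ω ⊆ E.domain) (hE' : ∀ p ∈ Ω, U p ∈ powDomain E'.n) : E'.n = E.n := by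
  obtain ⟨p, hp, hpne⟩ := h.exists_u_mul_U_ne_zero hΩ hne
  have dU := hasPD_of_smooth hΩ h.smooth_U hp eu
  have dUu := hasPD_of_smooth hΩ (smooth_pd hΩ h.smooth_U eu) hp eu
  rw [h.U_uu p hp] at dUu
  have e0 := (mul_eq_zero.1 (h.power_eq_ratio hΩ hE hE' p hp)).resolve_left hpne
  have e := HasPD.eq_of_eqOn hΩ hp (h.power_eq_ratio hΩ hE hE')
    ((hasPD_u.mul dU).mul (((hasPD_u.mul dUu).const_mul (E'.n - 2)).sub (dU.const_mul (E.n - 2))))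
    (hasPD_const 0)
  rw [e0] at e
  simp only [eu_components] at e
  have : p.2.2 * U p * ∂ᵤ U p * (E'.n - E.n) = 0 := by linear_combination e
  exact sub_eq_zero.1 ((mul_eq_zero.1 this).resolve_left (mul_ne_zero hpne (h.U_u p hp)))

end DeterminingEqs

/-- Powers are not multiplicative for negative bases in general. Here, for `u ≠ 0`, either `n` is an
integer, or `u` and `c u` are both positive and so is `c`. -/
theorem mul_rpow_mul_rpow {n c u : ℝ} (hn : n ≠ 1) (hc : c ≠ 0) (hu : u ∈ powDomain n)
    (hcu : c * u ∈ powDomain n) : (c * u) ^ (n - 1) * c ^ (1 - n) = u ^ (n - 1) := by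
  rcases eq_or_ne u 0 with rfl | hu0
  · simp [Real.zero_rpow (sub_ne_zero.2 hn)]
  have hint : (∃ k : ℤ, n = k) → (c * u) ^ (n - 1) * c ^ (1 - n) = u ^ (n - 1) := by
    rintro ⟨k, rfl⟩
    have e1 : (k : ℝ) - 1 = ((k - 1 : ℤ) : ℝ) := by push_cast; ring
    have e2 : (1 : ℝ) - k = ((-(k - 1) : ℤ) : ℝ) := by push_cast; ring
    rw [e1, e2, Real.rpow_intCast, Real.rpow_intCast, Real.rpow_intCast, mul_zpow, zpow_neg]
    have := zpow_ne_zero (k - 1) hc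
    field_simp
  have hnat : (∃ k : ℕ, n = k) → ∃ k : ℤ, n = k := fun ⟨k, hk⟩ => ⟨k, by simpa using hk⟩
  rcases hu with hu | ⟨hk, -⟩ | hk
  · rcases hcu with hcu | ⟨hk, -⟩ | hk
    · have hc' : 0 < c := pos_of_mul_pos_left hcu hu.le
      rw [Real.mul_rpow hc'.le hu.le, mul_right_comm, ← Real.rpow_add hc']
      simp
    · exact hint hk
    · exact hint (hnat hk)
  · exact hint hk
  · exact hint (hnat hk)

namespace DeterminingEqs

/-- Where `u U ≠ 0`, this is `power_eq_ratio` divided by `n - 2`. A zero of `U` with `u ≠ 0` would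
make the left side of `power_eq` vanish but not the right; points with `u = 0` are covered by
`eq_zero_of_u_mul_eq_zero`. -/
theorem U_eq_u_mul (h : DeterminingEqs E E' T X U Ω) (hΩ : IsOpen Ω) (hE : Ω ⊆ E.domain)
    (hE' : ∀ p ∈ Ω, U p ∈ powDomain E'.n) (hn : E'.n = E.n) (hn2 : E.n ≠ 2) :
    ∀ p ∈ Ω, U p = p.2.2 * ∂ᵤ U p := by
  have : ∀ p ∈ Ω, U p - p.2.2 * ∂ᵤ U p = 0 := by
    refine eq_zero_of_u_mul_eq_zero hΩ (fun q hq => ⟨_, (hasPD_of_smooth hΩ h.smooth_U hq eu).sub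
      (hasPD_u.mul (hasPD_of_smooth hΩ (smooth_pd hΩ h.smooth_U eu) hq eu))⟩) ?_
    intro p hp
    rcases eq_or_ne p.2.2 0 with hu | hu
    · simp [hu]
    have hU : U p ≠ 0 := by
      intro hU
      have e := h.power_eq hΩ hE hE' p hp
      rw [hU, hn, Real.zero_rpow (by intro e; apply hn2; linarith)] at e
      have := rpow_sub_one_ne_zero_of_mem_powDomain (hE hp).2 hu
      simp [h.X_x p hp, E.a_ne_zero, E.n_ne_zero, sub_ne_zero.2 E.n_ne_one, this] at e
    have e := (mul_eq_zero.1 (h.power_eq_ratio hΩ hE hE' p hp)).resolve_left (mul_ne_zero hu hU)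
    rw [hn] at e
    have e2 : (E.n - 2) * (U p - p.2.2 * ∂ᵤ U p) = 0 := by linear_combination -e
    rw [(mul_eq_zero.1 e2).resolve_left (sub_ne_zero.2 hn2), mul_zero]
  exact fun p hp => sub_eq_zero.1 (this p hp)

/-- With `V = U_u` and `U = u V`, eliminating `X_t` between `free` and `linear` gives `u Q = 0`,
where `Q = V V_t + 2 g V_x² + a n u^(n-1) V V_x - g V V_xx`. Only the power in `Q` depends on `u`,
so the `u`-derivative of `Q = 0` gives `V_x = 0`, and then `Q = 0` gives `V_t = 0`. -/
theorem U_u_const (h : DeterminingEqs E E' T X U Ω) (hΩ : IsOpen Ω) (hE : Ω ⊆ E.domain)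
    (hE' : ∀ p ∈ Ω, U p ∈ powDomain E'.n) (hn : E'.n = E.n) (hn2 : E.n ≠ 2) :
    ∀ p ∈ Ω, ∂ₓ (∂ᵤ U) p = 0 ∧ ∂ₜ (∂ᵤ U) p = 0 := by
  have hUV := h.U_eq_u_mul hΩ hE hE' hn hn2
  set V := ∂ᵤ U with hV
  have sV : ContDiffOn ℝ ∞ V Ω := smooth_pd hΩ h.smooth_U eu
  have sVx := smooth_pd hΩ sV ex
  have sVt := smooth_pd hΩ sV et
  have sVxx := smooth_pd hΩ sVx ex
  have hUx : ∀ p ∈ Ω, ∂ₓ U p = p.2.2 * ∂ₓ V p := by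
    intro p hp
    have := HasPD.eq_of_eqOn hΩ hp hUV (hasPD_of_smooth hΩ h.smooth_U hp ex)
      (hasPD_u.mul (hasPD_of_smooth hΩ sV hp ex))
    simpa using this
  have hUxx : ∀ p ∈ Ω, ∂ₓ (∂ₓ U) p = p.2.2 * ∂ₓ (∂ₓ V) p := by
    intro p hp
    have := HasPD.eq_of_eqOn hΩ hp hUx (hasPD_of_smooth hΩ (smooth_pd hΩ h.smooth_U ex) hp ex)
      (hasPD_u.mul (hasPD_of_smooth hΩ sVx hp ex))
    simpa using this
  have hUt : ∀ p ∈ Ω, ∂ₜ U p = p.2.2 * ∂ₜ V p := by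
    intro p hp
    have := HasPD.eq_of_eqOn hΩ hp hUV (hasPD_of_smooth hΩ h.smooth_U hp et)
      (hasPD_u.mul (hasPD_of_smooth hΩ sV hp et))
    simpa using this
  have hQd : ∀ p ∈ Ω, HasPD eu (fun p => V p * ∂ₜ V p + 2 * E.g p.1 * ∂ₓ V p * ∂ₓ V p
      + E.a * E.n * p.2.2 ^ (E.n - 1) * V p * ∂ₓ V p - E.g p.1 * V p * ∂ₓ (∂ₓ V) p)
      (E.a * E.n * ((E.n - 1) * p.2.2 ^ (E.n - 1 - 1)) * V p * ∂ₓ V p) p := by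
    intro p hp
    have dV := hasPD_of_smooth hΩ sV hp eu
    have dVt := hasPD_of_smooth hΩ sVt hp eu
    have dVx := hasPD_of_smooth hΩ sVx hp eu
    have dVxx := hasPD_of_smooth hΩ sVxx hp eu
    rw [h.U_uu p hp] at dV
    rw [pd_pd_eq_zero hΩ sV h.U_uu et p hp] at dVt
    rw [pd_pd_eq_zero hΩ sV h.U_uu ex p hp] at dVx
    rw [pd_pd_eq_zero hΩ sVx (pd_pd_eq_zero hΩ sV h.U_uu ex) ex p hp] at dVxx
    have dg := hasPD_g hE hp eu
    have := (((dV.mul dVt).add (((dg.const_mul 2).mul dVx).mul dVx)).add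
      ((((hasPD_u.rpow (E.ne_zero_or_one_le (hE hp).2)).const_mul (E.a * E.n)).mul dV).mul
        dVx)).sub ((dg.mul dV).mul dVxx)
    simpa using this
  have hQ := eq_zero_of_u_mul_eq_zero hΩ (fun p hp => ⟨_, hQd p hp⟩) (by
    intro p hp
    have e1 := h.linear p hp
    have e2 := h.free p hp
    rw [hUx p hp, hUxx p hp, hUt p hp] at e2
    apply (mul_eq_zero.1 (?_ : ∂ₓ X p * _ = 0)).resolve_left (h.X_x p hp)
    linear_combination V p * e2 - p.2.2 * ∂ₓ V p * e1)
  have hVx : ∀ p ∈ Ω, ∂ₓ V p = 0 := by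
    refine eq_zero_of_u_mul_eq_zero hΩ (fun p hp => ⟨_, hasPD_of_smooth hΩ sVx hp eu⟩) ?_
    intro p hp
    rcases eq_or_ne p.2.2 0 with hu | hu
    · simp [hu]
    have e := HasPD.eq_of_eqOn hΩ hp hQ (hQd p hp) (hasPD_const 0)
    have := rpow_sub_one_ne_zero_of_mem_powDomain (hE hp).2 hu
    have hVp : V p ≠ 0 := h.U_u p hp
    simp only [mul_eq_zero, E.a_ne_zero, E.n_ne_zero, sub_ne_zero.2 E.n_ne_one, this, hVp,
      false_or] at e
    rw [e, mul_zero]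
  refine fun p hp => ⟨hVx p hp, ?_⟩
  have e := hQ p hp
  rw [hVx p hp, pd_eq_zero_of_eqOn hΩ hp hVx] at e
  simp only [mul_zero, add_zero, sub_zero] at e
  exact (mul_eq_zero.1 e).resolve_left (h.U_u p hp)

theorem affine_of_ne_two (h : DeterminingEqs E E' T X U Ω) (hΩ : IsOpen Ω) (hc : IsConnected Ω)
    (hE : Ω ⊆ E.domain) (hE' : ∀ p ∈ Ω, U p ∈ powDomain E'.n) (hXxx : ∀ p ∈ Ω, ∂ₓ (∂ₓ X) p = 0)
    (hn : E'.n = E.n) (hn2 : E.n ≠ 2) :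
    ∃ δ₁ δ₂ δ₃ δ₄ δ₅ : ℝ, δ₁ * δ₃ * δ₅ ≠ 0 ∧ E'.a = δ₃ / δ₁ * δ₅ ^ (1 - E.n) * E.a ∧
      ∀ p ∈ Ω, T p = δ₁ * p.1 + δ₂ ∧ X p = δ₃ * p.2.1 + δ₄ ∧ U p = δ₅ * p.2.2 ∧
        E'.g (T p) = δ₃ ^ 2 / δ₁ * E.g p.1 := by
  obtain ⟨p₀, hp₀, hp₀ne⟩ := h.exists_u_mul_U_ne_zero hΩ hc.nonempty
  have hUV := h.U_eq_u_mul hΩ hE hE' hn hn2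
  have hV := h.U_u_const hΩ hE hE' hn hn2
  have sTt := smooth_pd hΩ h.smooth_T et
  have sXt := smooth_pd hΩ h.smooth_X et
  have sXx := smooth_pd hΩ h.smooth_X ex
  have sUu := smooth_pd hΩ h.smooth_U eu
  have e1 : ∀ p ∈ Ω, ∂ₜ T p * (E'.a * E.n * U p ^ (E.n - 1)) - ∂ₜ X p =
      ∂ₓ X p * (E.a * E.n * p.2.2 ^ (E.n - 1)) := by
    intro p hp
    have e := h.linear p hp
    rw [(hV p hp).1, hn] at e
    apply mul_right_cancel₀ (h.U_u p hp)
    linear_combination e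
  have hU0 : ∀ p ∈ Ω, p.2.2 ≠ 0 → U p ≠ 0 := fun p hp hu => by
    rw [hUV p hp]
    exact mul_ne_zero hu (h.U_u p hp)
  -- Since `u U_u = U`, `power_eq` multiplied by `u` is `e1` without the term `X_t`, up to the
  -- factor `n - 1`.
  have hXt : ∀ p ∈ Ω, ∂ₜ X p = 0 := by
    refine eq_zero_of_u_mul_eq_zero hΩ (fun p hp => ⟨_, hasPD_of_smooth hΩ sXt hp eu⟩) ?_
    intro p hp
    rcases eq_or_ne p.2.2 0 with hu | hu
    · simp [hu]
    have e := h.power_eq hΩ hE hE' p hp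
    rw [hn, Real.rpow_sub_one (hU0 p hp hu), Real.rpow_sub_one hu] at e
    have hUu := h.U_u p hp
    have hn1 := sub_ne_zero.2 E.n_ne_one
    have hUp := hU0 p hp hu
    field_simp at e
    have e3 := hUV p hp
    have e4 : ∂ₜ X p * U p = 0 := by
      linear_combination e - U p * e1 p hp + ∂ₜ T p * E'.a * E.n * U p ^ (E.n - 1) * e3
    rw [(mul_eq_zero.1 e4).resolve_right hUp, mul_zero]
  have e2 : ∀ p ∈ Ω, ∂ₜ T p * (E'.a * U p ^ (E.n - 1)) =
      ∂ₓ X p * (E.a * p.2.2 ^ (E.n - 1)) := by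
    intro p hp
    have e := e1 p hp
    rw [hXt p hp] at e
    apply mul_left_cancel₀ E.n_ne_zero
    linear_combination e
  have hUt : ∀ p ∈ Ω, ∂ₜ U p = 0 := by
    intro p hp
    have := HasPD.eq_of_eqOn hΩ hp hUV (hasPD_of_smooth hΩ h.smooth_U hp et)
      (hasPD_u.mul (hasPD_of_smooth hΩ sUu hp et))
    simpa [(hV p hp).2] using this
  have hXxt := pd_pd_eq_zero hΩ h.smooth_X hXt ex
  -- In `e2` every factor except possibly `T_t` is independent of `t`.
  have hTtt : ∀ p ∈ Ω, ∂ₜ (∂ₜ T) p = 0 := by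
    refine eq_zero_of_u_mul_eq_zero hΩ
      (fun p hp => ⟨_, hasPD_of_smooth hΩ (smooth_pd hΩ sTt et) hp eu⟩) ?_
    intro p hp
    rcases eq_or_ne p.2.2 0 with hu | hu
    · simp [hu]
    have dU := hasPD_of_smooth hΩ h.smooth_U hp et
    have dXx := hasPD_of_smooth hΩ sXx hp et
    rw [hUt p hp] at dU
    rw [hXxt p hp] at dXx
    have e := HasPD.eq_of_eqOn hΩ hp e2
      ((hasPD_of_smooth hΩ sTt hp et).mul ((dU.rpow (Or.inl (hU0 p hp hu))).const_mul _))
      (dXx.mul ((hasPD_u.rpow (Or.inl hu)).const_mul _))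
    have hne := rpow_ne_zero_of_mem_powDomain (hn ▸ hE' p hp) (hU0 p hp hu)
    simp only [et_components, mul_zero, zero_mul, add_zero, mul_eq_zero,
      E'.a_ne_zero, hne, or_false] at e
    rw [e, mul_zero]
  obtain ⟨δ₁, hδ₁⟩ := exists_affine hΩ hc sTt hTtt (pd_pd_eq_zero hΩ h.smooth_T h.T_x et)
    (pd_pd_eq_zero hΩ h.smooth_T h.T_u et)
  obtain ⟨δ₃, hδ₃⟩ := exists_affine hΩ hc sXx hXxt hXxx (pd_pd_eq_zero hΩ h.smooth_X h.X_u ex)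
  obtain ⟨δ₅, hδ₅⟩ := exists_affine hΩ hc sUu (fun p hp => (hV p hp).2) (fun p hp => (hV p hp).1)
    h.U_uu
  simp only [zero_mul, zero_add] at hδ₁ hδ₃ hδ₅
  obtain ⟨δ₂, hδ₂⟩ := exists_affine hΩ hc h.smooth_T hδ₁ h.T_x h.T_u
  obtain ⟨δ₄, hδ₄⟩ := exists_affine hΩ hc h.smooth_X hXt hδ₃ h.X_u
  simp only [zero_mul, zero_add, add_zero] at hδ₂ hδ₄
  have h1 : δ₁ ≠ 0 := hδ₁ p₀ hp₀ ▸ h.T_t p₀ hp₀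
  have h3 : δ₃ ≠ 0 := hδ₃ p₀ hp₀ ▸ h.X_x p₀ hp₀
  have h5 : δ₅ ≠ 0 := hδ₅ p₀ hp₀ ▸ h.U_u p₀ hp₀
  have hU5 : ∀ p ∈ Ω, U p = δ₅ * p.2.2 := fun p hp => by rw [hUV p hp, hδ₅ p hp, mul_comm]
  refine ⟨δ₁, δ₂, δ₃, δ₄, δ₅, mul_ne_zero (mul_ne_zero h1 h3) h5, ?_, fun p hp =>
    ⟨hδ₂ p hp, hδ₄ p hp, hU5 p hp, ?_⟩⟩
  · have e := e2 p₀ hp₀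
    have hd := hE' p₀ hp₀
    rw [hn, hU5 p₀ hp₀] at hd
    rw [hδ₁ p₀ hp₀, hδ₃ p₀ hp₀, hU5 p₀ hp₀,
      ← mul_rpow_mul_rpow E.n_ne_one h5 (hE hp₀).2 hd] at e
    have hne := rpow_ne_zero_of_mem_powDomain hd
      (hU5 p₀ hp₀ ▸ (right_ne_zero_of_mul hp₀ne))
    have e' : δ₁ * E'.a = δ₃ * (E.a * δ₅ ^ (1 - E.n)) :=
      mul_right_cancel₀ hne (by linear_combination e)
    field_simp
    linear_combination e'
  · have e := h.diffusion p hp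
    rw [hδ₁ p hp, hδ₃ p hp] at e
    field_simp
    linear_combination -e

end DeterminingEqs

end

/-! ### The quadratic case `n = 2` -/

section

variable {Ω : Set (ℝ × ℝ × ℝ)} {T X U : ℝ × ℝ × ℝ → ℝ} {E E' : Eqn}

namespace DeterminingEqs

/-- In the quadratic case `U` is determined by `T` and `X`, and these satisfy a system of ordinary
differential equations in `t`. -/
theorem quadratic_reduce (h : DeterminingEqs E E' T X U Ω) (hΩ : IsOpen Ω) (hE : Ω ⊆ E.domain)
    (hE' : ∀ p ∈ Ω, U p ∈ powDomain E'.n) (hXxx : ∀ p ∈ Ω, ∂ₓ (∂ₓ X) p = 0)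
    (hn : E'.n = 2) (hn2 : E.n = 2) : ∀ p ∈ Ω,
    2 * E'.a * ∂ₜ T p * U p = ∂ₜ X p + 2 * E.a * ∂ₓ X p * p.2.2 ∧
      2 * ∂ₜ (∂ₓ X) p * ∂ₜ T p = ∂ₜ (∂ₜ T) p * ∂ₓ X p ∧
      ∂ₜ (∂ₜ X) p * ∂ₜ T p = ∂ₜ (∂ₜ T) p * ∂ₜ X p := by
  have sTt := smooth_pd hΩ h.smooth_T et
  have sXt := smooth_pd hΩ h.smooth_X et
  have sXx := smooth_pd hΩ h.smooth_X ex
  have sUu := smooth_pd hΩ h.smooth_U eu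
  have sUx := smooth_pd hΩ h.smooth_U ex
  have hTtx := pd_pd_eq_zero hΩ h.smooth_T h.T_x et
  have hTtu := pd_pd_eq_zero hΩ h.smooth_T h.T_u et
  have hXtu := pd_pd_eq_zero hΩ h.smooth_X h.X_u et
  have hXxu := pd_pd_eq_zero hΩ h.smooth_X h.X_u ex
  have hXtx : ∀ p ∈ Ω, ∂ₓ (∂ₜ X) p = ∂ₜ (∂ₓ X) p := fun p hp => pd_comm hΩ h.smooth_X hp ex et
  have hUu : ∀ p ∈ Ω, ∂ₜ T p * (E'.a * ∂ᵤ U p) = E.a * ∂ₓ X p := by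
    intro p hp
    have e := h.power_eq hΩ hE hE' p hp
    rw [hn, hn2] at e
    norm_num at e
    linear_combination e / 2
  have hUux : ∀ p ∈ Ω, ∂ₓ (∂ᵤ U) p = 0 := by
    intro p hp
    have dTt := hasPD_of_smooth hΩ sTt hp ex
    have dXx := hasPD_of_smooth hΩ sXx hp ex
    rw [hTtx p hp] at dTt
    rw [hXxx p hp] at dXx
    have e := HasPD.eq_of_eqOn hΩ hp hUu
      (dTt.mul ((hasPD_of_smooth hΩ sUu hp ex).const_mul _)) (dXx.const_mul _)
    simpa [h.T_t p hp, E'.a_ne_zero] using e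
  have hU : ∀ p ∈ Ω, 2 * E'.a * ∂ₜ T p * U p = ∂ₜ X p + 2 * E.a * ∂ₓ X p * p.2.2 := by
    intro p hp
    have e := h.linear p hp
    rw [hn, hn2, hUux p hp] at e
    norm_num at e
    apply mul_right_cancel₀ (h.U_u p hp)
    linear_combination e
  have hUx : ∀ p ∈ Ω, 2 * E'.a * ∂ₜ T p * ∂ₓ U p = ∂ₜ (∂ₓ X) p := by
    intro p hp
    have dTt := hasPD_of_smooth hΩ sTt hp ex
    have dXx := hasPD_of_smooth hΩ sXx hp ex
    rw [hTtx p hp] at dTt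
    rw [hXxx p hp] at dXx
    have e := HasPD.eq_of_eqOn hΩ hp hU
      ((dTt.const_mul (2 * E'.a)).mul (hasPD_of_smooth hΩ h.smooth_U hp ex))
      ((hasPD_of_smooth hΩ sXt hp ex).add ((dXx.const_mul (2 * E.a)).mul hasPD_u))
    rw [hXtx p hp] at e
    simpa using e
  have hUxx : ∀ p ∈ Ω, ∂ₓ (∂ₓ U) p = 0 := by
    intro p hp
    have dTt := hasPD_of_smooth hΩ sTt hp ex
    rw [hTtx p hp] at dTt
    have e := HasPD.eq_of_eqOn hΩ hp hUx
      ((dTt.const_mul (2 * E'.a)).mul (hasPD_of_smooth hΩ sUx hp ex))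
      (hasPD_of_smooth hΩ (smooth_pd hΩ sXx et) hp ex)
    rw [pd_pd_eq_zero hΩ sXx hXxx et p hp] at e
    simpa [h.T_t p hp, E'.a_ne_zero] using e
  -- Substituting `hU` into `free` cancels `X_t`, and the diffusion term drops out since `U_xx = 0`.
  have hburgers : ∀ p ∈ Ω, ∂ₜ U p + 2 * E.a * p.2.2 * ∂ₓ U p = 0 := by
    intro p hp
    have e := h.free p hp
    rw [hn, hUxx p hp] at e
    norm_num at e
    apply mul_right_cancel₀ (h.X_x p hp)
    linear_combination e - ∂ₓ U p * hU p hp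
  -- Eliminating `U` leaves an identity affine in `u`, as `T` and `X` do not depend on `u`. Its
  -- `u`-derivative gives the equation for `X_tx`, and the remainder the one for `X_tt`.
  have hsplit : ∀ p ∈ Ω, ∂ₜ (∂ₜ T) p * ∂ₜ X p - ∂ₜ (∂ₜ X) p * ∂ₜ T p =
      2 * E.a * p.2.2 * (2 * ∂ₜ (∂ₓ X) p * ∂ₜ T p - ∂ₜ (∂ₜ T) p * ∂ₓ X p) := by
    intro p hp
    have e := HasPD.eq_of_eqOn hΩ hp hU
      (((hasPD_of_smooth hΩ sTt hp et).const_mul (2 * E'.a)).mul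
        (hasPD_of_smooth hΩ h.smooth_U hp et))
      ((hasPD_of_smooth hΩ sXt hp et).add
        (((hasPD_of_smooth hΩ sXx hp et).const_mul (2 * E.a)).mul hasPD_u))
    simp only [et_components, mul_zero, add_zero] at e
    linear_combination ∂ₜ T p * e - ∂ₜ (∂ₜ T) p * hU p hp
      - 2 * E'.a * ∂ₜ T p * ∂ₜ T p * hburgers p hp + 2 * E.a * p.2.2 * ∂ₜ T p * hUx p hp
  intro p hp
  have dTt := hasPD_of_smooth hΩ sTt hp eu
  have dTtt := hasPD_of_smooth hΩ (smooth_pd hΩ sTt et) hp eu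
  have dXt := hasPD_of_smooth hΩ sXt hp eu
  have dXtt := hasPD_of_smooth hΩ (smooth_pd hΩ sXt et) hp eu
  have dXx := hasPD_of_smooth hΩ sXx hp eu
  have dXxt := hasPD_of_smooth hΩ (smooth_pd hΩ sXx et) hp eu
  rw [hTtu p hp] at dTt
  rw [pd_pd_eq_zero hΩ sTt hTtu et p hp] at dTtt
  rw [hXtu p hp] at dXt
  rw [pd_pd_eq_zero hΩ sXt hXtu et p hp] at dXtt
  rw [hXxu p hp] at dXx
  rw [pd_pd_eq_zero hΩ sXx hXxu et p hp] at dXxt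
  have e := HasPD.eq_of_eqOn hΩ hp hsplit ((dTtt.mul dXt).sub (dXtt.mul dTt))
    ((hasPD_u.const_mul (2 * E.a)).mul (((dXxt.const_mul 2).mul dTt).sub (dTtt.mul dXx)))
  simp only [eu_components, mul_zero, zero_mul, add_zero, sub_zero, mul_one] at e
  have e2 : 2 * ∂ₜ (∂ₓ X) p * ∂ₜ T p - ∂ₜ (∂ₜ T) p * ∂ₓ X p = 0 := by
    simpa [E.a_ne_zero] using e.symm
  have e3 := hsplit p hp
  rw [e2] at e3
  exact ⟨hU p hp, sub_eq_zero.1 e2, by linear_combination -e3⟩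

/-- The reduced equations make `X_x² / T_t` and `X_tx / T_t` constant, so `X_tx` is a constant
multiple of `X_x²` and `1 / X_x` is an affine function `γ t + δ`. Multiplied by it, `T` and `X - x /
(γ t + δ)` become affine in `t`. The parameters other than `σ` matter only up to a common factor, so
`κ = 1` is no restriction. -/
theorem projective_of_eq_two (h : DeterminingEqs E E' T X U Ω) (hΩ : IsOpen Ω)
    (hc : IsConnected Ω) (hE : Ω ⊆ E.domain) (hE' : ∀ p ∈ Ω, U p ∈ powDomain E'.n)
    (hXxx : ∀ p ∈ Ω, ∂ₓ (∂ₓ X) p = 0) (hn : E'.n = 2) (hn2 : E.n = 2) :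
    ∃ α β γ δ μ₁ μ₀ : ℝ, α * δ - β * γ ≠ 0 ∧ ∀ p ∈ Ω, γ * p.1 + δ ≠ 0 ∧
      T p = (α * p.1 + β) / (γ * p.1 + δ) ∧
      X p = (p.2.1 + μ₁ * p.1 + μ₀) / (γ * p.1 + δ) ∧
      U p = 1 / (2 * E'.a * (α * δ - β * γ)) *
        (2 * E.a * (γ * p.1 + δ) * p.2.2 - γ * p.2.1 + μ₁ * δ - μ₀ * γ) ∧
      E'.g (T p) = 1 / (α * δ - β * γ) * E.g p.1 := by
  have hred := h.quadratic_reduce hΩ hE hE' hXxx hn hn2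
  obtain ⟨p₀, hp₀⟩ := hc.nonempty
  have sTt := smooth_pd hΩ h.smooth_T et
  have sXt := smooth_pd hΩ h.smooth_X et
  have sXx := smooth_pd hΩ h.smooth_X ex
  have sXxt := smooth_pd hΩ sXx et
  have hTtx := pd_pd_eq_zero hΩ h.smooth_T h.T_x et
  have hTtu := pd_pd_eq_zero hΩ h.smooth_T h.T_u et
  have hXtu := pd_pd_eq_zero hΩ h.smooth_X h.X_u et
  have hXxu := pd_pd_eq_zero hΩ h.smooth_X h.X_u ex
  have hXxtx := pd_pd_eq_zero hΩ sXx hXxx et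
  have hXxtu := pd_pd_eq_zero hΩ sXx hXxu et
  -- `X_x² / T_t` is constant.
  have sC : ContDiffOn ℝ ∞ (fun p => ∂ₓ X p * ∂ₓ X p / ∂ₜ T p) Ω := (sXx.mul sXx).div sTt h.T_t
  have dC : ∀ p ∈ Ω, ∀ v, pd v (fun p => ∂ₓ X p * ∂ₓ X p / ∂ₜ T p) p = _ := fun p hp v =>
    HasPD.pd_eq (differentiableAt_of_smooth hΩ sC hp)
      (((hasPD_of_smooth hΩ sXx hp v).mul (hasPD_of_smooth hΩ sXx hp v)).div
        (hasPD_of_smooth hΩ sTt hp v) (h.T_t p hp))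
  obtain ⟨C, hC⟩ := exists_affine hΩ hc sC (c₁ := 0) (c₂ := 0) (c₃ := 0)
    (fun p hp => by
      rw [dC p hp]
      apply div_eq_zero_iff.2 (Or.inl _)
      linear_combination ∂ₓ X p * (hred p hp).2.1)
    (fun p hp => by simp [dC p hp, hXxx p hp, hTtx p hp])
    (fun p hp => by simp [dC p hp, hXxu p hp, hTtu p hp])
  simp only [zero_mul, zero_add] at hC
  replace hC : ∀ p ∈ Ω, ∂ₓ X p * ∂ₓ X p = C * ∂ₜ T p := fun p hp => by
    rw [← hC p hp, div_mul_cancel₀ _ (h.T_t p hp)]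
  have hC0 : C ≠ 0 := by
    rintro rfl
    have := hC p₀ hp₀
    simp [h.X_x p₀ hp₀] at this
  -- `X_tx / T_t` is constant.
  have sM : ContDiffOn ℝ ∞ (fun p => ∂ₜ X p / ∂ₜ T p) Ω := sXt.div sTt h.T_t
  have dM : ∀ p ∈ Ω, ∀ v, pd v (fun p => ∂ₜ X p / ∂ₜ T p) p = _ := fun p hp v =>
    HasPD.pd_eq (differentiableAt_of_smooth hΩ sM hp)
      ((hasPD_of_smooth hΩ sXt hp v).div (hasPD_of_smooth hΩ sTt hp v) (h.T_t p hp))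
  have hMt : ∀ p ∈ Ω, ∂ₜ (fun p => ∂ₜ X p / ∂ₜ T p) p = 0 := fun p hp => by
    rw [dM p hp]
    apply div_eq_zero_iff.2 (Or.inl _)
    linear_combination (hred p hp).2.2
  have hMx : ∀ p ∈ Ω, ∂ₓ (fun p => ∂ₜ X p / ∂ₜ T p) p = ∂ₜ (∂ₓ X) p / ∂ₜ T p := fun p hp => by
    rw [dM p hp, hTtx p hp, pd_comm hΩ h.smooth_X hp ex et]
    have := h.T_t p hp
    field_simp
    ring
  have sN : ContDiffOn ℝ ∞ (fun p => ∂ₜ (∂ₓ X) p / ∂ₜ T p) Ω := sXxt.div sTt h.T_t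
  have dN : ∀ p ∈ Ω, ∀ v, pd v (fun p => ∂ₜ (∂ₓ X) p / ∂ₜ T p) p = _ := fun p hp v =>
    HasPD.pd_eq (differentiableAt_of_smooth hΩ sN hp)
      ((hasPD_of_smooth hΩ sXxt hp v).div (hasPD_of_smooth hΩ sTt hp v) (h.T_t p hp))
  -- The function is the `x`-derivative of `X_t / T_t`, which does not depend on `t`.
  obtain ⟨c, hcN⟩ := exists_affine hΩ hc sN (c₁ := 0) (c₂ := 0) (c₃ := 0)
    (fun p hp => by
      rw [← pd_eqOn hΩ hp hMx, pd_pd_eq_zero hΩ sM hMt ex p hp])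
    (fun p hp => by simp [dN p hp, hXxtx p hp, hTtx p hp])
    (fun p hp => by simp [dN p hp, hXxtu p hp, hTtu p hp])
  simp only [zero_mul, zero_add] at hcN
  replace hcN : ∀ p ∈ Ω, ∂ₜ (∂ₓ X) p = c * ∂ₜ T p := fun p hp => by
    rw [← hcN p hp, div_mul_cancel₀ _ (h.T_t p hp)]
  -- This choice gives `X_tx = -γ X_x²`, that is, `(1 / X_x)_t = γ`.
  obtain ⟨γ, hγ⟩ : ∃ γ, c = -γ * C := ⟨-c / C, by field_simp⟩
  have hXxt : ∀ p ∈ Ω, ∂ₜ (∂ₓ X) p = -γ * (∂ₓ X p * ∂ₓ X p) := fun p hp => by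
    rw [hcN p hp, hC p hp, hγ, mul_assoc]
  -- `1 / X_x` is affine in `t`.
  have sr : ContDiffOn ℝ ∞ (fun p => 1 / ∂ₓ X p) Ω := contDiffOn_const.div sXx h.X_x
  have dr : ∀ p ∈ Ω, ∀ v, HasPD v (fun p => 1 / ∂ₓ X p) _ p := fun p hp v =>
    (hasPD_const 1).div (hasPD_of_smooth hΩ sXx hp v) (h.X_x p hp)
  have dr' : ∀ p ∈ Ω, ∀ v, pd v (fun p => 1 / ∂ₓ X p) p = _ := fun p hp v =>
    HasPD.pd_eq (differentiableAt_of_smooth hΩ sr hp) (dr p hp v)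
  obtain ⟨δ, hr⟩ := exists_affine hΩ hc sr (c₁ := γ) (c₂ := 0) (c₃ := 0)
    (fun p hp => by
      rw [dr' p hp, hXxt p hp]
      have := h.X_x p hp
      field_simp
      ring)
    (fun p hp => by rw [dr' p hp, hXxx p hp]; simp) (fun p hp => by rw [dr' p hp, hXxu p hp]; simp)
  simp only [zero_mul, add_zero] at hr
  have hr1 : ∀ p ∈ Ω, ∂ₓ X p * (γ * p.1 + δ) = 1 := fun p hp => by
    rw [← hr p hp, mul_one_div_cancel (h.X_x p hp)]
  have hr0 : ∀ p ∈ Ω, γ * p.1 + δ ≠ 0 := fun p hp => right_ne_zero_of_mul_eq_one (hr1 p hp)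
  have hTtt : ∀ p ∈ Ω, ∂ₜ (∂ₜ T) p * (γ * p.1 + δ) = -2 * γ * ∂ₜ T p := fun p hp => by
    apply mul_right_cancel₀ (h.X_x p hp)
    linear_combination -(γ * p.1 + δ) * (hred p hp).2.1 + 2 * (γ * p.1 + δ) * ∂ₜ T p * hXxt p hp
      - 2 * γ * ∂ₜ T p * ∂ₓ X p * hr1 p hp
  have hXtt : ∀ p ∈ Ω, ∂ₜ (∂ₜ X) p * (γ * p.1 + δ) = -2 * γ * ∂ₜ X p := fun p hp => by
    apply mul_right_cancel₀ (h.T_t p hp)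
    linear_combination (γ * p.1 + δ) * (hred p hp).2.2 + ∂ₜ X p * hTtt p hp
  have haff : ContDiff ℝ ∞ (fun p : ℝ × ℝ × ℝ => γ * p.1 + δ) := by fun_prop
  have daff : ∀ (p v : ℝ × ℝ × ℝ), HasPD v (fun p => γ * p.1 + δ) (γ * v.1 + 0) p := fun p v =>
    (hasPD_t.const_mul γ).add (hasPD_const δ)
  -- `T (γ t + δ)` is affine in `t`.
  have sZ : ContDiffOn ℝ ∞ (fun p => T p * (γ * p.1 + δ)) Ω := h.smooth_T.mul haff.contDiffOn
  have dZ : ∀ p ∈ Ω, ∀ v, pd v (fun p => T p * (γ * p.1 + δ)) p = _ := fun p hp v =>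
    HasPD.pd_eq (differentiableAt_of_smooth hΩ sZ hp)
      ((hasPD_of_smooth hΩ h.smooth_T hp v).mul (daff p v))
  have hZx : ∀ p ∈ Ω, ∂ₓ (fun p => T p * (γ * p.1 + δ)) p = 0 := fun p hp => by
    simp [dZ p hp, h.T_x p hp]
  have hZu : ∀ p ∈ Ω, ∂ᵤ (fun p => T p * (γ * p.1 + δ)) p = 0 := fun p hp => by
    simp [dZ p hp, h.T_u p hp]
  have sZt := smooth_pd hΩ sZ et
  obtain ⟨α, hα⟩ := exists_affine hΩ hc sZt (c₁ := 0) (c₂ := 0) (c₃ := 0)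
    (fun p hp => HasPD.pd_eq (differentiableAt_of_smooth hΩ sZt hp) (by
      have := (((hasPD_of_smooth hΩ sTt hp et).mul (daff p et)).add
        ((hasPD_of_smooth hΩ h.smooth_T hp et).mul (hasPD_const (γ * et.1 + 0)))).congr hΩ hp
          (fun q hq => dZ q hq et)
      convert this using 1
      simp only [et_components]
      linear_combination -hTtt p hp))
    (pd_pd_eq_zero hΩ sZ hZx et) (pd_pd_eq_zero hΩ sZ hZu et)
  simp only [zero_mul, zero_add] at hα
  obtain ⟨β, hβ⟩ := exists_affine hΩ hc sZ hα hZx hZu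
  simp only [zero_mul, add_zero] at hβ
  -- `X (γ t + δ) - x` is affine in `t`.
  have sY : ContDiffOn ℝ ∞ (fun p => X p * (γ * p.1 + δ) - p.2.1) Ω :=
    (h.smooth_X.mul haff.contDiffOn).sub (ContDiff.contDiffOn (by fun_prop))
  have dY : ∀ p ∈ Ω, ∀ v, pd v (fun p => X p * (γ * p.1 + δ) - p.2.1) p = _ := fun p hp v =>
    HasPD.pd_eq (differentiableAt_of_smooth hΩ sY hp)
      (((hasPD_of_smooth hΩ h.smooth_X hp v).mul (daff p v)).sub hasPD_x)
  have hYx : ∀ p ∈ Ω, ∂ₓ (fun p => X p * (γ * p.1 + δ) - p.2.1) p = 0 := fun p hp => by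
    simp [dY p hp, hr1 p hp]
  have hYu : ∀ p ∈ Ω, ∂ᵤ (fun p => X p * (γ * p.1 + δ) - p.2.1) p = 0 := fun p hp => by
    simp [dY p hp, h.X_u p hp]
  have sYt := smooth_pd hΩ sY et
  obtain ⟨μ₁, hμ₁⟩ := exists_affine hΩ hc sYt (c₁ := 0) (c₂ := 0) (c₃ := 0)
    (fun p hp => HasPD.pd_eq (differentiableAt_of_smooth hΩ sYt hp) (by
      have := ((((hasPD_of_smooth hΩ sXt hp et).mul (daff p et)).add
        ((hasPD_of_smooth hΩ h.smooth_X hp et).mul (hasPD_const (γ * et.1 + 0)))).sub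
          (hasPD_const et.2.1)).congr hΩ hp (fun q hq => dY q hq et)
      convert this using 1
      simp only [et_components]
      linear_combination -hXtt p hp))
    (pd_pd_eq_zero hΩ sY hYx et) (pd_pd_eq_zero hΩ sY hYu et)
  simp only [zero_mul, zero_add] at hμ₁
  obtain ⟨μ₀, hμ₀⟩ := exists_affine hΩ hc sY hμ₁ hYx hYu
  simp only [zero_mul, add_zero] at hμ₀
  -- `T` is eliminated between `T (γ t + δ) = α t + β` and its `t`-derivative.
  have hdet : ∀ p ∈ Ω, α * δ - β * γ = ∂ₜ T p * (γ * p.1 + δ) ^ 2 := fun p hp => by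
    have e1 := hα p hp
    rw [dZ p hp] at e1
    simp only [et_components] at e1
    linear_combination γ * hβ p hp - (γ * p.1 + δ) * e1
  have hdetC : (α * δ - β * γ) * C = 1 := by
    have e := hr1 p₀ hp₀
    rw [hdet p₀ hp₀]
    linear_combination -(γ * p₀.1 + δ) ^ 2 * hC p₀ hp₀ +
      (∂ₓ X p₀ * (γ * p₀.1 + δ) + 1) * e
  have hdet0 : α * δ - β * γ ≠ 0 := left_ne_zero_of_mul_eq_one hdetC
  refine ⟨α, β, γ, δ, μ₁, μ₀, hdet0, fun p hp => ⟨hr0 p hp, ?_, ?_, ?_, ?_⟩⟩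
  · rw [eq_div_iff (hr0 p hp), hβ p hp]
  · rw [eq_div_iff (hr0 p hp)]
    linear_combination hμ₀ p hp
  · have e1 := hμ₁ p hp
    rw [dY p hp] at e1
    simp only [et_components] at e1
    have hXt : ∂ₜ X p * (γ * p.1 + δ) ^ 2 = μ₁ * δ - μ₀ * γ - γ * p.2.1 := by
      linear_combination (γ * p.1 + δ) * e1 - γ * hμ₀ p hp
    have e2 := (hred p hp).1
    have ha := E'.a_ne_zero
    rw [one_div_mul_eq_div, eq_div_iff (mul_ne_zero (mul_ne_zero two_ne_zero ha) hdet0)]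
    rw [hdet p hp]
    linear_combination (γ * p.1 + δ) ^ 2 * e2 + hXt
      + 2 * E.a * (γ * p.1 + δ) * p.2.2 * hr1 p hp
  · have e := h.diffusion p hp
    rw [hC p hp] at e
    have e3 : E'.g (T p) = C * E.g p.1 := mul_left_cancel₀ (h.T_t p hp) (by linear_combination -e)
    rw [e3, ← eq_one_div_of_mul_eq_one_right hdetC]

end DeterminingEqs

end

/-! ### Sufficiency: the group elements satisfy the determining equations -/

section

variable {Ω : Set (ℝ × ℝ × ℝ)} {T X U : ℝ × ℝ × ℝ → ℝ} {E E' : Eqn}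

theorem pd_eq_of_eqOn {F G : ℝ × ℝ × ℝ → ℝ} {p v : ℝ × ℝ × ℝ} {a : ℝ} (hΩ : IsOpen Ω)
    (h : ContDiffOn ℝ ∞ F Ω) (hp : p ∈ Ω) (e : ∀ q ∈ Ω, F q = G q) (hG : HasPD v G a p) :
    pd v F p = a :=
  HasPD.pd_eq (differentiableAt_of_smooth hΩ h hp) (hG.congr hΩ hp e)

theorem determiningEqs_of_affine {δ₁ δ₂ δ₃ δ₄ δ₅ : ℝ} (hΩ : IsOpen Ω)
    (hE : Ω ⊆ E.domain) (hE' : ∀ p ∈ Ω, U p ∈ powDomain E'.n) (hn : E'.n = E.n)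
    (hδ : δ₁ * δ₃ * δ₅ ≠ 0) (hT : ∀ p ∈ Ω, T p = δ₁ * p.1 + δ₂)
    (hX : ∀ p ∈ Ω, X p = δ₃ * p.2.1 + δ₄) (hU : ∀ p ∈ Ω, U p = δ₅ * p.2.2)
    (ha : ∀ p ∈ Ω, E'.a = δ₃ / δ₁ * δ₅ ^ (1 - E.n) * E.a)
    (hg : ∀ p ∈ Ω, E'.g (T p) = δ₃ ^ 2 / δ₁ * E.g p.1) : DeterminingEqs E E' T X U Ω := by
  obtain ⟨⟨h1, h3⟩, h5⟩ : (δ₁ ≠ 0 ∧ δ₃ ≠ 0) ∧ δ₅ ≠ 0 := by simpa [mul_ne_zero_iff] using hδ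
  have sT : ContDiffOn ℝ ∞ T Ω :=
    (ContDiff.contDiffOn (f := fun p : ℝ × ℝ × ℝ => δ₁ * p.1 + δ₂) (by fun_prop)).congr hT
  have sX : ContDiffOn ℝ ∞ X Ω :=
    (ContDiff.contDiffOn (f := fun p : ℝ × ℝ × ℝ => δ₃ * p.2.1 + δ₄) (by fun_prop)).congr hX
  have sU : ContDiffOn ℝ ∞ U Ω :=
    (ContDiff.contDiffOn (f := fun p : ℝ × ℝ × ℝ => δ₅ * p.2.2) (by fun_prop)).congr hU
  have dT : ∀ p ∈ Ω, ∀ v, pd v T p = δ₁ * v.1 + 0 := fun p hp v =>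
    pd_eq_of_eqOn hΩ sT hp hT ((hasPD_t.const_mul δ₁).add (hasPD_const δ₂))
  have dX : ∀ p ∈ Ω, ∀ v, pd v X p = δ₃ * v.2.1 + 0 := fun p hp v =>
    pd_eq_of_eqOn hΩ sX hp hX ((hasPD_x.const_mul δ₃).add (hasPD_const δ₄))
  have dU : ∀ p ∈ Ω, ∀ v, pd v U p = δ₅ * v.2.2 := fun p hp v =>
    pd_eq_of_eqOn hΩ sU hp hU (hasPD_u.const_mul δ₅)
  have ddU : ∀ p ∈ Ω, ∀ v w, pd v (pd w U) p = 0 := fun p hp v w =>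
    pd_eq_zero_of_eqOn hΩ hp (fun q hq => dU q hq w) v
  refine ⟨sT, sX, sU, ?_, ?_, ?_, ?_, ?_, ?_, ?_, ?_, ?_, ?_⟩ <;> intro p hp <;>
    simp only [dT p hp, dX p hp, dU p hp, ddU p hp, et_components, ex_components, eu_components,
      mul_zero, mul_one, add_zero, zero_add, sub_zero, zero_mul]
  · exact h1
  · exact h3
  · exact h5
  · rw [hg p hp]
    field_simp
  -- What remains is `linear`: the factor `δ₅ ^ (1 - n)` in the new `a` absorbs the rescaling of the
  -- power.
  · have hd := hE' p hp
    rw [hn, hU p hp] at hd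
    rw [hn, hU p hp, ha p hp, ← mul_rpow_mul_rpow E.n_ne_one h5 (hE hp).2 hd]
    field_simp

theorem determiningEqs_of_projective {α β γ δ κ μ₁ μ₀ σ : ℝ} (hΩ : IsOpen Ω)
    (hn : E'.n = 2) (hn2 : E.n = 2)
    (hdet : α * δ - β * γ ≠ 0) (hκσ : κ * σ ≠ 0) (hr : ∀ p ∈ Ω, γ * p.1 + δ ≠ 0)
    (hT : ∀ p ∈ Ω, T p = (α * p.1 + β) / (γ * p.1 + δ))
    (hX : ∀ p ∈ Ω, X p = (κ * p.2.1 + μ₁ * p.1 + μ₀) / (γ * p.1 + δ))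
    (hU : ∀ p ∈ Ω, U p = σ / (2 * E.a * (α * δ - β * γ)) *
      (2 * E.a * κ * (γ * p.1 + δ) * p.2.2 - κ * γ * p.2.1 + μ₁ * δ - μ₀ * γ))
    (ha : ∀ p ∈ Ω, E'.a = E.a / σ)
    (hg : ∀ p ∈ Ω, E'.g (T p) = κ ^ 2 / (α * δ - β * γ) * E.g p.1) :
    DeterminingEqs E E' T X U Ω := by
  obtain ⟨hκ, hσ⟩ := mul_ne_zero_iff.1 hκσ
  have ha0 := E.a_ne_zero
  have sr : ContDiffOn ℝ ∞ (fun p : ℝ × ℝ × ℝ => γ * p.1 + δ) Ω :=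
    ContDiff.contDiffOn (by fun_prop)
  have sT : ContDiffOn ℝ ∞ T Ω :=
    ((ContDiff.contDiffOn (f := fun p : ℝ × ℝ × ℝ => α * p.1 + β) (by fun_prop)).div sr hr).congr hT
  have sX : ContDiffOn ℝ ∞ X Ω :=
    ((ContDiff.contDiffOn (f := fun p : ℝ × ℝ × ℝ => κ * p.2.1 + μ₁ * p.1 + μ₀)
      (by fun_prop)).div sr hr).congr hX
  have sU : ContDiffOn ℝ ∞ U Ω :=
    (ContDiff.contDiffOn (f := fun p : ℝ × ℝ × ℝ => σ / (2 * E.a * (α * δ - β * γ)) *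
      (2 * E.a * κ * (γ * p.1 + δ) * p.2.2 - κ * γ * p.2.1 + μ₁ * δ - μ₀ * γ))
      (by fun_prop)).congr hU
  have dr : ∀ (p v : ℝ × ℝ × ℝ), HasPD v (fun p => γ * p.1 + δ) (γ * v.1 + 0) p := fun p v =>
    (hasPD_t.const_mul γ).add (hasPD_const δ)
  have dT : ∀ p ∈ Ω, ∀ v, pd v T p = (α * δ - β * γ) * v.1 / (γ * p.1 + δ) ^ 2 := fun p hp v => by
    rw [pd_eq_of_eqOn hΩ sT hp hT
      (((hasPD_t.const_mul α).add (hasPD_const β)).div (dr p v) (hr p hp))]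
    ring
  have dX : ∀ p ∈ Ω, ∀ v, pd v X p = ((κ * v.2.1) * (γ * p.1 + δ)
      + (μ₁ * δ - μ₀ * γ - κ * γ * p.2.1) * v.1) / (γ * p.1 + δ) ^ 2 := fun p hp v => by
    rw [pd_eq_of_eqOn hΩ sX hp hX ((((hasPD_x.const_mul κ).add (hasPD_t.const_mul μ₁)).add
      (hasPD_const μ₀)).div (dr p v) (hr p hp))]
    ring
  have dU : ∀ p ∈ Ω, ∀ v, pd v U p = σ / (2 * E.a * (α * δ - β * γ)) *
      (2 * E.a * κ * (γ * v.1 * p.2.2 + (γ * p.1 + δ) * v.2.2) - κ * γ * v.2.1) :=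
    fun p hp v => by
      rw [pd_eq_of_eqOn hΩ sU hp hU ((((((dr p v).const_mul (2 * E.a * κ)).mul hasPD_u).sub
        (hasPD_x.const_mul (κ * γ))).add (hasPD_const (μ₁ * δ))).sub
          (hasPD_const (μ₀ * γ))|>.const_mul _)]
      ring
  -- Only the term `t u` of `U` is nonlinear, so `U_tu` is the only second derivative that can be
  -- nonzero.
  have ddU : ∀ p ∈ Ω, ∀ v w, pd v (pd w U) p = σ / (2 * E.a * (α * δ - β * γ)) *
      (2 * E.a * κ * (γ * w.1 * v.2.2 + γ * v.1 * w.2.2)) := fun p hp v w => by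
    rw [pd_eq_of_eqOn hΩ (smooth_pd hΩ sU w) hp (fun q hq => dU q hq w)
      (((((hasPD_u.const_mul (γ * w.1)).add ((dr p v).mul (hasPD_const w.2.2))).const_mul
        (2 * E.a * κ)).sub (hasPD_const _)).const_mul _)]
    ring
  refine ⟨sT, sX, sU, ?_, ?_, ?_, ?_, ?_, ?_, ?_, ?_, ?_, ?_⟩ <;> intro p hp <;>
    have hrp := hr p hp <;>
    simp only [dT p hp, dX p hp, dU p hp, ddU p hp, et_components, ex_components, eu_components,
      mul_zero, mul_one, add_zero, zero_add, sub_zero, zero_mul, zero_div]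
  · exact div_ne_zero hdet (pow_ne_zero 2 hrp)
  · exact div_ne_zero (mul_ne_zero hκ hrp) (pow_ne_zero 2 hrp)
  · exact mul_ne_zero (div_ne_zero hσ (mul_ne_zero (mul_ne_zero two_ne_zero ha0) hdet))
      (mul_ne_zero (mul_ne_zero (mul_ne_zero two_ne_zero ha0) hκ) hrp)
  · rw [hg p hp]
    generalize α * δ - β * γ = D at hdet
    field_simp
  · rw [hn, hn2, ha p hp, show (2 : ℝ) - 1 = 1 by norm_num, Real.rpow_one, Real.rpow_one, hU p hp]
    field_simp
    ring
  · rw [hn, ha p hp, show (2 : ℝ) - 1 = 1 by norm_num, Real.rpow_one, hU p hp]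
    field_simp
    ring

end

end GenBurgers

/-- All point transformations between two equations of the class, on a connected open region of the
space `(t, x, u)` on which both equations make sense. -/
theorem theorem3 (E E' : GenBurgers.Eqn) (Ω : Set (ℝ × ℝ × ℝ))
    (hΩ_open : IsOpen Ω) (hΩ_conn : IsConnected Ω) (hΩ : Ω ⊆ E.domain)
    (Φ : ℝ × ℝ × ℝ → ℝ × ℝ × ℝ) (hΦ : Set.MapsTo Φ Ω E'.domain) :
    GenBurgers.Connects Φ Ω E E' ↔
      E'.n = E.n ∧
      (E.n ≠ 2 → ∃ S : GenBurgers.UsualEquiv, GenBurgers.ProjectsTo S.act Φ Ω E E') ∧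
      (E.n = 2 → ∃ S : GenBurgers.GeneralizedEquiv,
        (∀ p ∈ Ω, S.γ * p.1 + S.δ ≠ 0) ∧ GenBurgers.ProjectsTo S.act Φ Ω E E') := by
  open GenBurgers in
  have hE' : ∀ p ∈ Ω, compU Φ p ∈ powDomain E'.n := fun p hp => (hΦ hp).2
  rw [GenBurgers.connects_iff_determiningEqs hΩ_open hΩ hΦ]
  constructor
  · intro h
    have hn := h.n_eq hΩ_open hΩ_conn.nonempty hΩ hE'
    have hXxx := GenBurgers.X_xx_eq_zero hΩ_open h.smooth_T h.smooth_X hΩ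
      (fun p hp => (hΦ hp).1) h.T_x h.X_x h.diffusion
    refine ⟨hn, fun hn2 => ?_, fun hn2 => ?_⟩
    · obtain ⟨δ₁, δ₂, δ₃, δ₄, δ₅, hδ, ha, hp⟩ :=
        h.affine_of_ne_two hΩ_open hΩ_conn hΩ hE' hXxx hn hn2
      refine ⟨⟨δ₁, δ₂, δ₃, δ₄, δ₅, hδ⟩, fun p hpΩ => ?_⟩
      obtain ⟨h1, h2, h3, h4⟩ := hp p hpΩ
      exact GenBurgers.ExtPoint.mk.injEq .. ▸
        ⟨h1.symm, h2.symm, h3.symm, ha.symm, h4.symm, hn.symm⟩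
    · obtain ⟨α, β, γ, δ, μ₁, μ₀, hdet, hp⟩ :=
        h.projective_of_eq_two hΩ_open hΩ_conn hΩ hE' hXxx (hn.trans hn2) hn2
      have ha := E.a_ne_zero
      have ha' := E'.a_ne_zero
      -- The normalization is `κ = 1`, and `σ = a / a'` is dictated by the law for `a`.
      refine ⟨⟨α, β, γ, δ, 1, μ₁, μ₀, E.a / E'.a, hdet, by simp [ha, ha']⟩,
        fun p hpΩ => (hp p hpΩ).1, fun p hpΩ => ?_⟩
      obtain ⟨-, h1, h2, h3, h4⟩ := hp p hpΩ
      refine GenBurgers.ExtPoint.mk.injEq .. ▸ ⟨h1.symm, ?_, ?_, ?_, ?_, hn.symm⟩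
      · refine Eq.trans ?_ h2.symm
        simp [GenBurgers.Eqn.lift]
      · refine Eq.trans ?_ h3.symm
        simp only [GenBurgers.Eqn.lift]
        field_simp
      · simp only [GenBurgers.Eqn.lift]
        field_simp
      · refine Eq.trans ?_ h4.symm
        simp [GenBurgers.Eqn.lift]
  · rintro ⟨hn, h1, h2⟩
    by_cases hn2 : E.n = 2
    · obtain ⟨S, hr, hS⟩ := h2 hn2
      exact GenBurgers.determiningEqs_of_projective hΩ_open (hn.trans hn2) hn2 S.det_ne_zero
        S.ne_zero hr (fun p hp => (congrArg GenBurgers.ExtPoint.t (hS p hp)).symm)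
        (fun p hp => (congrArg GenBurgers.ExtPoint.x (hS p hp)).symm)
        (fun p hp => (congrArg GenBurgers.ExtPoint.u (hS p hp)).symm)
        (fun p hp => (congrArg GenBurgers.ExtPoint.a (hS p hp)).symm)
        (fun p hp => (congrArg GenBurgers.ExtPoint.g (hS p hp)).symm)
    · obtain ⟨S, hS⟩ := h1 hn2
      exact GenBurgers.determiningEqs_of_affine hΩ_open hΩ hE' hn S.ne_zero
        (fun p hp => (congrArg GenBurgers.ExtPoint.t (hS p hp)).symm)
        (fun p hp => (congrArg GenBurgers.ExtPoint.x (hS p hp)).symm)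
        (fun p hp => (congrArg GenBurgers.ExtPoint.u (hS p hp)).symm)
        (fun p hp => (congrArg GenBurgers.ExtPoint.a (hS p hp)).symm)
        (fun p hp => (congrArg GenBurgers.ExtPoint.g (hS p hp)).symm)
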